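/- Let $\Lambda$ be a $d$-dimensional lattice: a connected bipartite graph in $\mathbb R^d$ whose white vertices are a linear image $W$ of $\mathbb Z^d$, whose black vertices are a translate of $W$ disjoint from $W$, and in which each white vertex $w$ is joined exactly to $w+e_1,\dots,w+e_D$, where $e_1,\dots,e_D$ are distinct vectors with $\sum_j e_j=0$. Let $\mathcal N=\operatorname{conv}\{e_1,\dots,e_D\}$ be its Newton polytope, $F(\alpha)=\log\sum_{j=1}^D \exp(e_j\cdot\alpha)$ its free energy, and let the surface tension be the Legendre dual $\sigma(s)=\sup_{\alpha\in\mathbb R^d}\,(s\cdot\alpha-F(\alpha))$ for $s\in\mathcal N$. Let $R\subset\mathbb R^d$ be compact and let $b$ be a finite signed measure on $\mathbb R^d$. An asymptotic flow on $R$ is a measurable vector field that vanishes a.e. outside $R$, takes values in $\mathcal N$ a.e. on $R$, and is divergence-free on $R^\circ$ as a distribution; $AF(\Lambda,R,b)$ is the set of asymptotic flows $\omega$ with boundary value (outward flux through $\partial R$) $b$, i.e. $\int_R\omega\cdot\nabla\varphi\,dx=\int\varphi\,db$ for all $\varphi\in C_c^\infty(\mathbb R^d)$. A limit shape flow for $(R,b)$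 is a minimizer of $\int_R\sigma(\omega(x))\,dx$ over $AF(\Lambda,R,b)$. **Theorem.** The surface tension $\sigma$ is $C^\infty$ on $\mathcal N^\circ$. If $\omega$ is a limit shape flow for $(R,b)$, then it solves the system $$\operatorname{div}\omega=\sum_{i=1}^d\frac{\partial\omega_i}{\partial x_i}=0,\qquad \frac{\partial}{\partial x_i}\frac{\partial\sigma}{\partial s_j}(\omega(x))-\frac{\partial}{\partial x_j}\frac{\partial\sigma}{\partial s_i}(\omega(x))=0\quad(i\ne j)$$ in the following sense. 1. The divergence equation holds on $R^\circ$ in the sense of distributions. 2. On every open $U\subset R^\circ$ each point of which has a neighbourhood on which $\omega$ takes a.e. its values in a compact subset of $\mathcal N^\circ$, the functions $\partial_{s_i}\sigma(\omega)$ are locally integrable and the remaining equations hold in the sense of distributions. 3. On every open $U\subset R^\circ$ on which $\omega$ is $C^1$ with values in $\mathcal N^\circ$, all the equations hold at every point. Conversely, suppose that for some $x_0$ one has $x_0+t(x-x_0)\in R^\circ$ for all $x\in R$ and $0\le t<1$ (for instance, $R$ is convex with non-empty interior). If $\omega\in AF(\Lambda,R,b)$ takes values in $\mathcal N^\circ$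 a.e. on $R$, the functions $\partial_{s_i}\sigma(\omega)$ are integrable on $R$, and the equations for $i\ne j$ hold on $R^\circ$ in the sense of distributions, then $\omega$ is a limit shape flow for $(R,b)$, and every limit shape flow for $(R,b)$ equals $\omega$ almost everywhere. -/

import Mathlib

open MeasureTheory Set Topology


noncomputable section

namespace MultinomialDimer

/-- Euclidean space `ℝ^d`. -/
abbrev E (d : ℕ) := EuclideanSpace ℝ (Fin d)

/-! ### Lattices -/

/-- The data of a bipartite graph in `ℝ^d` with one white and one black orbit of translations:
a basis whose integer span is the set of white vertices, a vector `offset` translating the white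
vertices onto the black ones, and the vectors `edge 0, …, edge (D-1)` of the edges at a white
vertex, pointing from white to black. -/
structure LatticeData (d : ℕ) where
  basis : Module.Basis (Fin d) ℝ (E d)
  offset : E d
  D : ℕ
  edge : Fin D → E d

/-- The white vertices: a linear image of `ℤ^d`. -/
def LatticeData.white {d : ℕ} (L : LatticeData d) : Set (E d) :=
  (Submodule.span ℤ (range L.basis) : Set (E d))

/-- The black vertices: a translate of the white ones. -/
def LatticeData.black {d : ℕ} (L : LatticeData d) : Set (E d) :=
  {x | x - L.offset ∈ L.white}

/-- The graph: every white vertex `w` is joined to `w + edge i` for all `i`. -/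
def LatticeData.graph {d : ℕ} (L : LatticeData d) :
    SimpleGraph {x : E d // x ∈ L.white ∪ L.black} :=
  SimpleGraph.fromRel fun x y => x.1 ∈ L.white ∧ ∃ i, y.1 = x.1 + L.edge i

/-- A `d`-dimensional lattice: a connected, harmonically embedded, `D`-regular bipartite graph in
`ℝ^d` on which translations act transitively on white and on black vertices. -/
structure DimerLattice (d : ℕ) extends LatticeData d where
  offset_notMem : offset ∉ toLatticeData.white
  edge_injective : Function.Injective edge
  edge_mem : ∀ i, edge i ∈ toLatticeData.black
  connected : toLatticeData.graph.Connected
  harmonic : ∑ i, edge i = 0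

/-- The Newton polytope: the convex hull of the edge vectors at a white vertex. -/
def newtonPolytope {d : ℕ} (Λ : DimerLattice d) : Set (E d) :=
  convexHull ℝ (range Λ.edge)

/-- The free energy `F(α) = log ∑_j exp (e_j · α)`. -/
def freeEnergy {d : ℕ} (Λ : DimerLattice d) (α : E d) : ℝ :=
  Real.log (∑ j, Real.exp (inner ℝ (Λ.edge j) α))

/-- The surface tension `σ`, the Legendre dual of the free energy. Its domain is the Newton
polytope, on which the supremum is finite; values elsewhere are never used. -/
def surfaceTension {d : ℕ} (Λ : DimerLattice d) (s : E d) : ℝ :=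
  ⨆ α : E d, (inner ℝ s α - freeEnergy Λ α)

/-! ### Flows -/

/-- The partial derivative `∂f/∂x_i` at `x`. -/
def partialDeriv {d : ℕ} (i : Fin d) (f : E d → ℝ) (x : E d) : ℝ :=
  fderiv ℝ f x (EuclideanSpace.single i 1)

/-- `φ` is a smooth function with compact support contained in `U`. -/
structure IsTestFunction {d : ℕ} (U : Set (E d)) (φ : E d → ℝ) : Prop where
  smooth : ContDiff ℝ ((⊤ : ℕ∞) : WithTop ℕ∞) φ
  compact : HasCompactSupport φ
  support : tsupport φ ⊆ U

/-- `ω` is divergence-free on `U` as a distribution: `∫_U ω · ∇φ = 0` for all test functions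
(`fderiv ℝ φ x (ω x)` is `ω(x) · ∇φ(x)`). -/
def IsDivFree {d : ℕ} (U : Set (E d)) (ω : E d → E d) : Prop :=
  ∀ φ : E d → ℝ, IsTestFunction U φ → ∫ x in U, fderiv ℝ φ x (ω x) = 0

/-- Asymptotic flows on `R`: measurable vector fields supported in `R`, divergence-free in the
interior of `R` as distributions, with values in the Newton polytope. As usual, flows are
considered up to null sets. -/
structure IsAsymptoticFlow {d : ℕ} (Λ : DimerLattice d) (R : Set (E d)) (ω : E d → E d) :
    Prop where
  aemeasurable : AEMeasurable ω volume
  support : ∀ᵐ x, x ∉ R → ω x = 0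
  divFree : IsDivFree (interior R) ω
  mem : ∀ᵐ x, x ∈ R → ω x ∈ newtonPolytope Λ

/-- The boundary value (outward flux through `∂R`) of a flow `ω` that is divergence-free in the
interior of `R` is the signed measure `b`, that is, Green's formula `∫_R ω · ∇φ dx = ∫ φ db` holds
for all smooth compactly supported `φ` on `ℝ^d`. If `ω` is smooth up to a piecewise smooth
boundary with outward unit normal `ξ`, this says that `b` is `⟨ω, ξ⟩` times surface measure; the
condition is continuous for weak convergence of flows and measures. -/
def HasBoundaryValue {d : ℕ} (R : Set (E d)) (ω : E d → E d) (b : SignedMeasure (E d)) : Prop :=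
  ∀ φ : E d → ℝ, IsTestFunction univ φ →
    ∫ x in R, fderiv ℝ φ x (ω x) =
      (∫ x, φ x ∂b.toJordanDecomposition.posPart) - ∫ x, φ x ∂b.toJordanDecomposition.negPart

/-- The class `AF(Λ, R, b)` of asymptotic flows on `R` with boundary value `b`. -/
def AF {d : ℕ} (Λ : DimerLattice d) (R : Set (E d)) (b : SignedMeasure (E d)) :
    Set (E d → E d) :=
  {ω | IsAsymptoticFlow Λ R ω ∧ HasBoundaryValue R ω b}

/-- `ω` is the limit shape flow for `(R, b)`: it minimizes `∫_R σ(ω(x)) dx` over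
`AF(Λ, R, b)`. -/
def IsLimitShape {d : ℕ} (Λ : DimerLattice d) (R : Set (E d)) (b : SignedMeasure (E d))
    (ω : E d → E d) : Prop :=
  ω ∈ AF Λ R b ∧ ∀ ω' ∈ AF Λ R b,
    ∫ x in R, surfaceTension Λ (ω x) ≤ ∫ x in R, surfaceTension Λ (ω' x)

/-! ### The Euler-Lagrange system -/

/-- The function `x ↦ (∂σ/∂s_i)(ω(x))`. -/
def gauge {d : ℕ} (Λ : DimerLattice d) (ω : E d → E d) (i : Fin d) (x : E d) : ℝ :=
  partialDeriv i (surfaceTension Λ) (ω x)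

/-- On `U`, the flow locally stays, almost everywhere, in a compact subset of the interior of the
Newton polytope. -/
def StaysInside {d : ℕ} (Λ : DimerLattice d) (U : Set (E d)) (ω : E d → E d) : Prop :=
  ∀ x ∈ U, ∃ V ∈ 𝓝 x, ∃ K : Set (E d), IsCompact K ∧ K ⊆ interior (newtonPolytope Λ) ∧
    ∀ᵐ y, y ∈ V → ω y ∈ K

/-- The equations `∂_{x_i} (∂_{s_j} σ)(ω) - ∂_{x_j} (∂_{s_i} σ)(ω) = 0`, `i ≠ j`, on `U` in the
sense of distributions. -/
def SolvesELWeakly {d : ℕ} (Λ : DimerLattice d) (U : Set (E d)) (ω : E d → E d) : Prop :=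
  (∀ i, LocallyIntegrableOn (gauge Λ ω i) U) ∧
  ∀ i j, i ≠ j → ∀ φ : E d → ℝ, IsTestFunction U φ →
    ∫ x in U, (gauge Λ ω j x * partialDeriv i φ x - gauge Λ ω i x * partialDeriv j φ x) = 0

/-- The divergence equation and the equations
`∂_{x_i} (∂_{s_j} σ)(ω(x)) - ∂_{x_j} (∂_{s_i} σ)(ω(x)) = 0`, `i ≠ j`, at every point of `U`. -/
def SolvesELClassically {d : ℕ} (Λ : DimerLattice d) (U : Set (E d)) (ω : E d → E d) : Prop :=
  ∀ x ∈ U, ∑ i, partialDeriv i (fun y => ω y i) x = 0 ∧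
    ∀ i j, i ≠ j →
      partialDeriv i (gauge Λ ω j) x - partialDeriv j (gauge Λ ω i) x = 0

end MultinomialDimer

end

/-! Everything rests on convex duality between `freeEnergy` and `surfaceTension`. The gradient of
the free energy at α is the Gibbs mean of the edge vectors, `meanEdge`, and its derivative is their
covariance, which is nondegenerate as soon as the Newton polytope has an interior point. For s in
the interior, α ↦ F(α) - s·α is coercive, so s = ∇F(α) for some α (`exists_meanEdge_eq`). The
inverse function theorem then makes σ smooth, with ∇σ(∇F(α)) = α. The subgradient inequality for σ
at interior points follows (`fderiv_surfaceTension_le`). It is strict: equality at s' makes α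
optimal for s' too, hence s' = ∇F(α) = s, even for s' on the boundary of the polytope.

Necessity of the equations is a first variation. The field ∂_jφ e_i - ∂_iφ e_j is orthogonal to all
gradients and compactly supported, so adding a small multiple of it to ω changes neither divergence
nor boundary value. Where ω stays in a compact part of the interior, the perturbed field is a
competitor. Minimality, for φ and -φ, gives the weak equations. On C¹ pieces they become pointwise
by integration by parts and the fundamental lemma.

For the converse, integrate the subgradient inequality at ω(x) towards a competitor ω'. It suffices
that ∇σ(ω) be orthogonal to η = ω' - ω, a bounded field orthogonal to gradients of test functions
(`setIntegral_sum_mul_eq_zero`). A curl-free field that is merely integrable on R need not have a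
usable potential up to the boundary. Composing its mollification with a dilation that moves R into
its interior gives a smooth field, curl-free on a star-shaped neighbourhood of R. That field is a
gradient by the Poincaré lemma, hence orthogonal to η, and it converges in L¹ to the original field.
Strictness of the subgradient inequality gives uniqueness. -/

namespace MultinomialDimer

variable {d : ℕ} (Λ : DimerLattice d)

/-! ### Convex duality for the surface tension -/

/-- The partition function `∑_j exp (e_j · α)`. -/
noncomputable def partitionSum (α : E d) : ℝ :=
  ∑ j, Real.exp (inner ℝ (Λ.edge j) α)

/-- The mean of the edge vectors for the Gibbs weights at `α`; this is the gradient of the free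
energy. -/
noncomputable def meanEdge (α : E d) : E d :=
  (partitionSum Λ α)⁻¹ • ∑ j, Real.exp (inner ℝ (Λ.edge j) α) • Λ.edge j

variable {Λ}

lemma nonempty_edges {s : E d} (hs : s ∈ newtonPolytope Λ) : Nonempty (Fin Λ.D) := by
  have : (range Λ.edge).Nonempty := convexHull_nonempty_iff.1 ⟨s, hs⟩
  exact range_nonempty_iff_nonempty.1 this

lemma partitionSum_pos [Nonempty (Fin Λ.D)] (α : E d) : 0 < partitionSum Λ α :=
  Finset.sum_pos (fun _ _ => Real.exp_pos _) Finset.univ_nonempty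

lemma exp_freeEnergy [Nonempty (Fin Λ.D)] (α : E d) :
    Real.exp (freeEnergy Λ α) = partitionSum Λ α :=
  Real.exp_log (partitionSum_pos α)

lemma contDiff_partitionSum {n : WithTop ℕ∞} : ContDiff ℝ n (partitionSum Λ) := by
  unfold partitionSum
  exact ContDiff.sum fun j _ => (contDiff_const.inner ℝ contDiff_id).exp

lemma contDiff_freeEnergy [Nonempty (Fin Λ.D)] {n : WithTop ℕ∞} : ContDiff ℝ n (freeEnergy Λ) :=
  contDiff_partitionSum.log fun α => (partitionSum_pos α).ne'

lemma contDiff_meanEdge [Nonempty (Fin Λ.D)] {n : WithTop ℕ∞} : ContDiff ℝ n (meanEdge Λ) := by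
  have h : ContDiff ℝ n fun α => (partitionSum Λ α)⁻¹ :=
    contDiff_partitionSum.inv fun α => (partitionSum_pos α).ne'
  exact h.smul (ContDiff.sum fun j _ =>
    ((contDiff_const.inner ℝ contDiff_id).exp).smul contDiff_const)

lemma inner_meanEdge (α v : E d) : inner ℝ (meanEdge Λ α) v =
    (partitionSum Λ α)⁻¹ *
      ∑ j, Real.exp (inner ℝ (Λ.edge j) α) * inner ℝ (Λ.edge j) v := by
  simp [meanEdge, real_inner_smul_left, sum_inner]

lemma hasFDerivAt_partitionSum (α : E d) :
    HasFDerivAt (partitionSum Λ)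
      (∑ j, Real.exp (inner ℝ (Λ.edge j) α) • innerSL ℝ (Λ.edge j)) α :=
  HasFDerivAt.fun_sum fun j _ => (innerSL ℝ (Λ.edge j)).hasFDerivAt.exp

lemma hasFDerivAt_freeEnergy [Nonempty (Fin Λ.D)] (α : E d) :
    HasFDerivAt (freeEnergy Λ) (innerSL ℝ (meanEdge Λ α)) α := by
  have h := (hasFDerivAt_partitionSum (Λ := Λ) α).log (partitionSum_pos α).ne'
  have heq : innerSL ℝ (meanEdge Λ α) =
      (partitionSum Λ α)⁻¹ • ∑ j, Real.exp (inner ℝ (Λ.edge j) α) • innerSL ℝ (Λ.edge j) := by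
    simp [meanEdge]
  rw [heq]
  exact h

/-- Jensen's inequality for the Gibbs weights at α: apply 1 + x ≤ exp x to the deviation of each
e_j·(β - α) from its mean c. The deviations average to zero, so Z(α) exp c ≤ Z(β). -/
lemma freeEnergy_convex [Nonempty (Fin Λ.D)] (α β : E d) :
    freeEnergy Λ α + inner ℝ (meanEdge Λ α) (β - α) ≤ freeEnergy Λ β := by
  set c := inner ℝ (meanEdge Λ α) (β - α) with hc
  have hZ := partitionSum_pos (Λ := Λ) α
  have hsum : ∑ j, Real.exp (inner ℝ (Λ.edge j) α) * inner ℝ (Λ.edge j) (β - α) =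
      partitionSum Λ α * c := by
    rw [hc, inner_meanEdge, mul_inv_cancel_left₀ hZ.ne']
  have key : partitionSum Λ α * Real.exp c ≤ partitionSum Λ β := by
    calc partitionSum Λ α * Real.exp c
        = Real.exp c * ∑ j, Real.exp (inner ℝ (Λ.edge j) α) *
            (1 + (inner ℝ (Λ.edge j) (β - α) - c)) := by
          have : ∑ j, Real.exp (inner ℝ (Λ.edge j) α) *
              (1 + (inner ℝ (Λ.edge j) (β - α) - c)) = partitionSum Λ α := by
            simp_rw [mul_add, mul_sub, mul_one]
            rw [Finset.sum_add_distrib, Finset.sum_sub_distrib, hsum, ← Finset.sum_mul]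
            simp [partitionSum]
          rw [this, mul_comm]
      _ ≤ Real.exp c * ∑ j, Real.exp (inner ℝ (Λ.edge j) α) *
            Real.exp (inner ℝ (Λ.edge j) (β - α) - c) := by
          gcongr with j
          linarith [Real.add_one_le_exp (inner ℝ (Λ.edge j) (β - α) - c)]
      _ = partitionSum Λ β := by
          rw [Finset.mul_sum]
          refine Finset.sum_congr rfl fun j _ => ?_
          rw [← Real.exp_add, ← Real.exp_add, inner_sub_right]
          congr 1
          ring
  rw [← Real.exp_le_exp, Real.exp_add, exp_freeEnergy, exp_freeEnergy]
  exact key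

/-- At a vertex this drops all but one term of the partition function; a half-space containing the
vertices contains their hull. It keeps the supremum defining σ finite on the polytope. -/
lemma inner_le_freeEnergy {s : E d} (hs : s ∈ newtonPolytope Λ) (α : E d) :
    inner ℝ s α ≤ freeEnergy Λ α := by
  have := nonempty_edges hs
  have hconv : Convex ℝ {x : E d | inner ℝ x α ≤ freeEnergy Λ α} :=
    convex_halfSpace_le (IsLinearMap.mk (fun x y => inner_add_left x y α)
      (fun c x => by simp [real_inner_smul_left])) _
  refine convexHull_min ?_ hconv hs
  rintro _ ⟨j, rfl⟩
  rw [mem_ofPred_eq, ← Real.exp_le_exp, exp_freeEnergy]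
  exact Finset.single_le_sum (f := fun j => Real.exp (inner ℝ (Λ.edge j) α))
    (fun _ _ => (Real.exp_pos _).le) (Finset.mem_univ j)

lemma bddAbove_surfaceTension {s : E d} (hs : s ∈ newtonPolytope Λ) :
    BddAbove (range fun α : E d => inner ℝ s α - freeEnergy Λ α) :=
  ⟨0, by rintro _ ⟨α, rfl⟩; exact sub_nonpos.2 (inner_le_freeEnergy hs α)⟩

lemma le_surfaceTension {s : E d} (hs : s ∈ newtonPolytope Λ) (α : E d) :
    inner ℝ s α - freeEnergy Λ α ≤ surfaceTension Λ s :=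
  le_ciSup (bddAbove_surfaceTension hs) α

lemma surfaceTension_nonpos {s : E d} (hs : s ∈ newtonPolytope Λ) : surfaceTension Λ s ≤ 0 :=
  ciSup_le fun α => sub_nonpos.2 (inner_le_freeEnergy hs α)

lemma neg_log_le_surfaceTension {s : E d} (hs : s ∈ newtonPolytope Λ) :
    -Real.log Λ.D ≤ surfaceTension Λ s := by
  simpa [freeEnergy] using le_surfaceTension hs 0

lemma abs_surfaceTension_le {s : E d} (hs : s ∈ newtonPolytope Λ) :
    |surfaceTension Λ s| ≤ |Real.log Λ.D| := by
  have h₁ := surfaceTension_nonpos hs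
  have h₂ := neg_log_le_surfaceTension hs
  rw [abs_of_nonpos h₁]
  exact (neg_le.1 h₂).trans (le_abs_self _)

lemma surfaceTension_meanEdge [Nonempty (Fin Λ.D)] (α : E d) :
    surfaceTension Λ (meanEdge Λ α) = inner ℝ (meanEdge Λ α) α - freeEnergy Λ α := by
  have h : ∀ β : E d, inner ℝ (meanEdge Λ α) β - freeEnergy Λ β ≤
      inner ℝ (meanEdge Λ α) α - freeEnergy Λ α := fun β => by
    have := freeEnergy_convex (Λ := Λ) α β
    rw [inner_sub_right] at this
    linarith
  exact le_antisymm (ciSup_le h) (le_ciSup (f := fun β : E d =>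
    inner ℝ (meanEdge Λ α) β - freeEnergy Λ β) ⟨_, by rintro _ ⟨β, rfl⟩; exact h β⟩ α)

/-- A maximizer in the Legendre transform is a point where the gradient of `F` is `s`. -/
lemma meanEdge_eq_of_forall_le [Nonempty (Fin Λ.D)] {s α : E d}
    (h : ∀ β : E d, freeEnergy Λ α - inner ℝ s α ≤ freeEnergy Λ β - inner ℝ s β) :
    meanEdge Λ α = s := by
  have hmin : IsLocalMin (fun β : E d => freeEnergy Λ β - inner ℝ s β) α :=
    Filter.Eventually.of_forall h
  have hd := hmin.hasFDerivAt_eq_zero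
    ((hasFDerivAt_freeEnergy α).sub (innerSL ℝ s).hasFDerivAt)
  rw [← map_sub] at hd
  have := congrArg (fun L => L (meanEdge Λ α - s)) hd
  simp only [innerSL_apply_apply, zero_apply, inner_self_eq_zero] at this
  exact sub_eq_zero.1 this

/-- Direct method: room around s inside the polytope makes F(α) - s·α grow at least linearly, so a
minimizer exists, and the gradient vanishes there. -/
lemma exists_meanEdge_eq {s : E d} (hs : s ∈ interior (newtonPolytope Λ)) :
    ∃ α, meanEdge Λ α = s := by
  have := nonempty_edges (interior_subset hs)
  obtain ⟨r, hr, hball⟩ := Metric.mem_nhds_iff.1 (mem_interior_iff_mem_nhds.1 hs)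
  have hbound : ∀ α : E d, (r / 2) * ‖α‖ ≤ freeEnergy Λ α - inner ℝ s α := fun α => by
    rcases eq_or_ne α 0 with rfl | hα
    · have := inner_le_freeEnergy (interior_subset hs) (0 : E d)
      simpa using this
    · have hn : 0 < ‖α‖ := norm_pos_iff.2 hα
      -- Shift s by length r/2 in the direction of α, the best direction for bounding F(α) from
      -- below.
      have hmem : s + (r / 2 / ‖α‖) • α ∈ newtonPolytope Λ := hball (by
        rw [Metric.mem_ball, dist_eq_norm, add_sub_cancel_left, norm_smul, Real.norm_eq_abs,
          abs_of_pos (by positivity), div_mul_cancel₀ _ hn.ne']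
        linarith)
      have h := inner_le_freeEnergy hmem α
      rw [inner_add_left, real_inner_smul_left, real_inner_self_eq_norm_sq] at h
      have : r / 2 / ‖α‖ * ‖α‖ ^ 2 = r / 2 * ‖α‖ := by field_simp
      linarith
  have hcont : Continuous fun α : E d => freeEnergy Λ α - inner ℝ s α :=
    (contDiff_freeEnergy (n := 0)).continuous.sub (by fun_prop)
  have htend : Filter.Tendsto (fun α : E d => freeEnergy Λ α - inner ℝ s α)
      (Filter.cocompact (E d)) Filter.atTop :=
    Filter.tendsto_atTop_mono hbound
      ((tendsto_norm_cocompact_atTop (E := E d)).const_mul_atTop (half_pos hr))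
  obtain ⟨α, hα⟩ := hcont.exists_forall_le htend
  exact ⟨α, meanEdge_eq_of_forall_le hα⟩

/-- The values of the edge vectors against a nonzero functional are not all equal. -/
lemma eq_zero_of_forall_inner_edge_eq {s v : E d} (hs : s ∈ interior (newtonPolytope Λ)) {c : ℝ}
    (h : ∀ j, inner ℝ (Λ.edge j) v = c) : v = 0 := by
  have hconv : Convex ℝ {x : E d | inner ℝ x v = c} :=
    convex_hyperplane (IsLinearMap.mk (fun x y => inner_add_left x y v)
      (fun c x => by simp [real_inner_smul_left])) _
  have hsub : newtonPolytope Λ ⊆ {x : E d | inner ℝ x v = c} :=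
    convexHull_min (by rintro _ ⟨j, rfl⟩; exact h j) hconv
  have hev : ∀ᶠ t : ℝ in 𝓝[>] 0, s + t • v ∈ newtonPolytope Λ := by
    have hc : Filter.Tendsto (fun t : ℝ => s + t • v) (𝓝[>] 0) (𝓝 s) := by
      have : ContinuousAt (fun t : ℝ => s + t • v) 0 := by fun_prop
      simpa [ContinuousAt] using this.tendsto.mono_left nhdsWithin_le_nhds
    exact hc (mem_interior_iff_mem_nhds.1 hs)
  obtain ⟨t, ht, ht0⟩ := (hev.and self_mem_nhdsWithin).exists
  have h₁ : inner ℝ (s + t • v) v = c := hsub ht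
  have h₂ : inner ℝ s v = c := hsub (interior_subset hs)
  rw [inner_add_left, real_inner_smul_left, h₂] at h₁
  have : t * inner ℝ v v = 0 := by linarith
  rcases mul_eq_zero.1 this with h | h
  · exact absurd h (ne_of_gt ht0)
  · exact inner_self_eq_zero.1 h

/-- The right side is the variance of e_j·v under the Gibbs weights, with the normalizing factor
pulled out. -/
lemma fderiv_meanEdge_apply [Nonempty (Fin Λ.D)] (α v : E d) :
    inner ℝ (fderiv ℝ (meanEdge Λ) α v) v =
      (partitionSum Λ α)⁻¹ ^ 2 * (partitionSum Λ α *
        ∑ j, Real.exp (inner ℝ (Λ.edge j) α) * inner ℝ (Λ.edge j) v ^ 2 -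
        (∑ j, Real.exp (inner ℝ (Λ.edge j) α) * inner ℝ (Λ.edge j) v) ^ 2) := by
  have hZ := (partitionSum_pos (Λ := Λ) α).ne'
  have h₁ : HasFDerivAt (fun α : E d => ∑ j, Real.exp (inner ℝ (Λ.edge j) α) • Λ.edge j)
      (∑ j, (Real.exp (inner ℝ (Λ.edge j) α) • innerSL ℝ (Λ.edge j)).smulRight (Λ.edge j)) α :=
    HasFDerivAt.fun_sum fun j _ =>
      ((innerSL ℝ (Λ.edge j)).hasFDerivAt.exp).smul_const (Λ.edge j)
  have h₂ : HasFDerivAt (fun α : E d => (partitionSum Λ α)⁻¹) _ α :=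
    (hasDerivAt_inv hZ).comp_hasFDerivAt α (hasFDerivAt_partitionSum α)
  have h₃ : HasFDerivAt (meanEdge Λ) _ α := h₂.smul h₁
  rw [h₃.fderiv]
  simp only [add_apply, FunLike.coe_smul, Pi.smul_apply,
    ContinuousLinearMap.smulRight_apply, sum_apply, innerSL_apply_apply,
    inner_add_left, real_inner_smul_left, sum_inner, smul_eq_mul]
  simp only [mul_assoc, ← pow_two]
  field_simp
  ring

/-- A kernel vector v has zero variance, so e_j·v is the same for all j; edges spanning a polytope
with interior then force v = 0. -/
lemma fderiv_meanEdge_injective {s : E d} (hs : s ∈ interior (newtonPolytope Λ)) (α : E d) :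
    Function.Injective (fderiv ℝ (meanEdge Λ) α) := by
  have := nonempty_edges (interior_subset hs)
  refine (injective_iff_map_eq_zero _).2 fun v hv => ?_
  have hZ := partitionSum_pos (Λ := Λ) α
  set Z := partitionSum Λ α with hZdef
  set w : Fin Λ.D → ℝ := fun j => Real.exp (inner ℝ (Λ.edge j) α) with hw
  set x : Fin Λ.D → ℝ := fun j => inner ℝ (Λ.edge j) v with hx
  have hzero : Z * ∑ j, w j * x j ^ 2 - (∑ j, w j * x j) ^ 2 = 0 := by
    have h := fderiv_meanEdge_apply (Λ := Λ) α v
    rw [hv, inner_zero_left, eq_comm] at h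
    exact (mul_eq_zero.1 h).resolve_left (by positivity)
  set X := ∑ j, w j * x j with hX
  have hsum : ∑ j, w j * (Z * x j - X) ^ 2 = 0 := by
    have : ∑ j, w j * (Z * x j - X) ^ 2 =
        Z ^ 2 * ∑ j, w j * x j ^ 2 - 2 * Z * X * X + X ^ 2 * Z := by
      have hterm : ∀ j, w j * (Z * x j - X) ^ 2 =
          Z ^ 2 * (w j * x j ^ 2) - 2 * Z * X * (w j * x j) + X ^ 2 * w j := fun j => by ring
      simp_rw [hterm]
      rw [Finset.sum_add_distrib, Finset.sum_sub_distrib, ← Finset.mul_sum, ← Finset.mul_sum,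
        ← Finset.mul_sum]
      rfl
    rw [this]
    linear_combination Z * hzero
  have hall := (Finset.sum_eq_zero_iff_of_nonneg fun j _ =>
    mul_nonneg (Real.exp_pos _).le (sq_nonneg _)).1 hsum
  refine eq_zero_of_forall_inner_edge_eq hs (c := X / Z) fun j => ?_
  have h := (mul_eq_zero.1 (hall j (Finset.mem_univ j))).resolve_left (Real.exp_pos _).ne'
  have := pow_eq_zero_iff (two_ne_zero) |>.1 h
  rw [eq_div_iff hZ.ne']
  linarith

/-- With g a smooth local inverse of ∇F, the supremum is attained at g(s), so σ(s) = s·g(s) -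
F(g(s)) near the point. Only that g is a right inverse is used. -/
lemma contDiffAt_surfaceTension {s : E d} (hs : s ∈ interior (newtonPolytope Λ)) :
    ContDiffAt ℝ ((⊤ : ℕ∞) : WithTop ℕ∞) (surfaceTension Λ) s := by
  have := nonempty_edges (interior_subset hs)
  obtain ⟨α, rfl⟩ := exists_meanEdge_eq hs
  set H : E d ≃L[ℝ] E d := (LinearEquiv.ofInjectiveEndo
    (fderiv ℝ (meanEdge Λ) α).toLinearMap
    (fderiv_meanEdge_injective hs α)).toContinuousLinearEquiv with hH
  have hsm : ContDiffAt ℝ ((⊤ : ℕ∞) : WithTop ℕ∞) (meanEdge Λ) α := contDiff_meanEdge.contDiffAt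
  have hder : HasFDerivAt (meanEdge Λ) (H : E d →L[ℝ] E d) α := by
    have : (H : E d →L[ℝ] E d) = fderiv ℝ (meanEdge Λ) α := by
      ext1 v
      rfl
    rw [this]
    exact (hsm.differentiableAt (by simp)).hasFDerivAt
  have hn : ((⊤ : ℕ∞) : WithTop ℕ∞) ≠ 0 := by simp
  have hg := hsm.to_localInverse hder hn
  have hinv : ∀ᶠ s in 𝓝 (meanEdge Λ α), meanEdge Λ (hsm.localInverse hder hn s) = s :=
    (hsm.hasStrictFDerivAt' hder hn).eventually_right_inverse
  refine ContDiffAt.congr_of_eventuallyEq (f := fun s => inner ℝ s (hsm.localInverse hder hn s) -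
    freeEnergy Λ (hsm.localInverse hder hn s)) ?_ ?_
  · exact (contDiffAt_id.inner ℝ hg).sub (contDiff_freeEnergy.contDiffAt.comp _ hg)
  · filter_upwards [hinv] with s hs
    conv_lhs => rw [← hs, surfaceTension_meanEdge, hs]

lemma hasFDerivAt_surfaceTension [Nonempty (Fin Λ.D)] {α : E d}
    (hs : meanEdge Λ α ∈ interior (newtonPolytope Λ)) :
    HasFDerivAt (surfaceTension Λ) (innerSL ℝ α) (meanEdge Λ α) := by
  have hd := ((contDiffAt_surfaceTension hs).differentiableAt (by simp)).hasFDerivAt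
  -- The Legendre inequality bounds this function below by -F(α), with equality at ∇F(α).
  have hmin : IsLocalMin (fun s => surfaceTension Λ s - inner ℝ α s) (meanEdge Λ α) := by
    filter_upwards [mem_interior_iff_mem_nhds.1 hs] with s hs'
    have := le_surfaceTension hs' α
    rw [surfaceTension_meanEdge, real_inner_comm (meanEdge Λ α) α, real_inner_comm s α]
    linarith
  have h := hmin.hasFDerivAt_eq_zero (hd.sub (innerSL ℝ α).hasFDerivAt)
  rwa [sub_eq_zero.1 h] at hd

lemma contDiffOn_surfaceTension : ContDiffOn ℝ ((⊤ : ℕ∞) : WithTop ℕ∞) (surfaceTension Λ)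
    (interior (newtonPolytope Λ)) :=
  fun _ hs => (contDiffAt_surfaceTension hs).contDiffWithinAt

lemma contDiffOn_fderiv_surfaceTension : ContDiffOn ℝ ((⊤ : ℕ∞) : WithTop ℕ∞)
    (fderiv ℝ (surfaceTension Λ)) (interior (newtonPolytope Λ)) :=
  ((contDiffOn_infty_iff_fderiv_of_isOpen isOpen_interior).1 contDiffOn_surfaceTension).2

/-- The subgradient inequality at interior points. -/
lemma fderiv_surfaceTension_le {s s' : E d} (hs : s ∈ interior (newtonPolytope Λ))
    (hs' : s' ∈ newtonPolytope Λ) :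
    fderiv ℝ (surfaceTension Λ) s (s' - s) ≤ surfaceTension Λ s' - surfaceTension Λ s := by
  have := nonempty_edges hs'
  obtain ⟨α, rfl⟩ := exists_meanEdge_eq hs
  have := le_surfaceTension hs' α
  rw [(hasFDerivAt_surfaceTension hs).fderiv, innerSL_apply_apply, inner_sub_right,
    surfaceTension_meanEdge, real_inner_comm α s', real_inner_comm α (meanEdge Λ α)] at *
  linarith

/-- Equality in the subgradient inequality at an interior point `s` holds only at `s`. -/
lemma eq_of_fderiv_surfaceTension_eq {s s' : E d} (hs : s ∈ interior (newtonPolytope Λ))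
    (hs' : s' ∈ newtonPolytope Λ)
    (h : fderiv ℝ (surfaceTension Λ) s (s' - s) = surfaceTension Λ s' - surfaceTension Λ s) :
    s' = s := by
  have := nonempty_edges hs'
  obtain ⟨α, rfl⟩ := exists_meanEdge_eq hs
  rw [(hasFDerivAt_surfaceTension hs).fderiv, innerSL_apply_apply, inner_sub_right,
    surfaceTension_meanEdge, real_inner_comm s' α, real_inner_comm (meanEdge Λ α) α] at h
  -- Equality says that α attains the supremum defining σ(s'), so the gradient of F at α is s' as
  -- well.
  refine (meanEdge_eq_of_forall_le fun β => ?_).symm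
  have := le_surfaceTension hs' β
  linarith

lemma isCompact_newtonPolytope : IsCompact (newtonPolytope Λ) :=
  (finite_range Λ.edge).isCompact_convexHull ℝ

/-- The surface tension agrees on the Newton polytope with a measurable function. -/
lemma exists_measurable_eqOn_surfaceTension :
    ∃ f : E d → ℝ, Measurable f ∧ EqOn f (surfaceTension Λ) (newtonPolytope Λ) := by
  rcases (newtonPolytope Λ).eq_empty_or_nonempty with h | ⟨s₀, hs₀⟩
  · exact ⟨0, measurable_zero, by simp [h]⟩
  have := nonempty_edges hs₀
  refine ⟨(newtonPolytope Λ).indicator fun s => surfaceTension Λ s, ?_, fun s hs => by simp [hs]⟩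
  refine measurable_of_Ioi fun c => ?_
  have hN : MeasurableSet (newtonPolytope Λ) := isCompact_newtonPolytope.isClosed.measurableSet
  -- A supremum of continuous affine functions is lower semicontinuous: its superlevel sets are
  -- relatively open.
  have hset : newtonPolytope Λ ∩ {s | c < surfaceTension Λ s} =
      newtonPolytope Λ ∩ ⋃ α : E d, {s | c < inner ℝ s α - freeEnergy Λ α} := by
    ext s
    simp only [mem_inter_iff, mem_ofPred_eq, mem_iUnion, and_congr_right_iff]
    exact fun hs => lt_ciSup_iff (bddAbove_surfaceTension hs)
  have hm : MeasurableSet (newtonPolytope Λ ∩ {s | c < surfaceTension Λ s}) := by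
    rw [hset]
    refine hN.inter (IsOpen.measurableSet (isOpen_iUnion fun α => ?_))
    exact isOpen_lt continuous_const (by fun_prop)
  have : (newtonPolytope Λ).indicator (fun s => surfaceTension Λ s) ⁻¹' Ioi c =
      (newtonPolytope Λ ∩ {s | c < surfaceTension Λ s}) ∪
        ((newtonPolytope Λ)ᶜ ∩ {_s | c < 0}) := by
    ext s
    by_cases hs : s ∈ newtonPolytope Λ <;> simp [hs]
  rw [this]
  exact hm.union (hN.compl.inter (MeasurableSet.const _))

/-! ### Test functions and integration by parts -/

lemma IsTestFunction.mono {U V : Set (E d)} {φ : E d → ℝ} (hφ : IsTestFunction U φ)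
    (h : U ⊆ V) : IsTestFunction V φ :=
  ⟨hφ.smooth, hφ.compact, hφ.support.trans h⟩

lemma IsTestFunction.neg {U : Set (E d)} {φ : E d → ℝ} (hφ : IsTestFunction U φ) :
    IsTestFunction U (fun x => -φ x) := by
  have h : tsupport (fun x => -φ x) = tsupport φ := by
    unfold tsupport
    rw [Function.support_fun_neg]
  refine ⟨hφ.smooth.neg, ?_, h ▸ hφ.support⟩
  rw [HasCompactSupport, h]
  exact hφ.compact

lemma contDiff_partialDeriv {φ : E d → ℝ} (hφ : ContDiff ℝ ((⊤ : ℕ∞) : WithTop ℕ∞) φ)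
    (i : Fin d) : ContDiff ℝ ((⊤ : ℕ∞) : WithTop ℕ∞) (partialDeriv i φ) :=
  (hφ.fderiv_right (by simp)).clm_apply contDiff_const

lemma tsupport_partialDeriv_subset (φ : E d → ℝ) (i : Fin d) :
    tsupport (partialDeriv i φ) ⊆ tsupport φ :=
  tsupport_fderiv_apply_subset ℝ _

lemma partialDeriv_eq_zero_of_notMem_tsupport {φ : E d → ℝ} {x : E d} (hx : x ∉ tsupport φ)
    (i : Fin d) : partialDeriv i φ x = 0 :=
  image_eq_zero_of_notMem_tsupport fun h => hx (tsupport_partialDeriv_subset φ i h)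

lemma fderiv_eq_zero_of_notMem_tsupport {φ : E d → ℝ} {x : E d} (hx : x ∉ tsupport φ) :
    fderiv ℝ φ x = 0 :=
  image_eq_zero_of_notMem_tsupport fun h => hx (tsupport_fderiv_subset ℝ h)

lemma fderiv_eq_sum_partialDeriv (φ : E d → ℝ) (x v : E d) :
    fderiv ℝ φ x v = ∑ i, partialDeriv i φ x * v i := by
  conv_lhs => rw [← (EuclideanSpace.basisFun (Fin d) ℝ).sum_repr v]
  simp [partialDeriv, mul_comm]

lemma integrable_partialDeriv {f : E d → ℝ} (hf : ContDiff ℝ 1 f) (hc : HasCompactSupport f)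
    (i : Fin d) : Integrable (partialDeriv i f) :=
  ((hf.continuous_fderiv one_ne_zero).clm_apply continuous_const).integrable_of_hasCompactSupport
    (hc.fderiv_apply ℝ _)

lemma integral_partialDeriv_eq_zero {f : E d → ℝ} (hf : ContDiff ℝ 1 f)
    (hc : HasCompactSupport f) (i : Fin d) : ∫ x, partialDeriv i f x = 0 := by
  have h := integral_mul_fderiv_eq_neg_fderiv_mul_of_integrable (μ := (volume : Measure (E d)))
    (f := fun _ : E d => (1 : ℝ)) (g := f) (v := EuclideanSpace.single i 1)
    (by simp) (by simpa using! integrable_partialDeriv hf hc i)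
    (by simpa using hf.continuous.integrable_of_hasCompactSupport hc)
    (fun x _ => differentiableAt_const _) (fun x _ => hf.differentiable one_ne_zero x)
  simpa [partialDeriv] using h

lemma partialDeriv_mul {f g : E d → ℝ} {x : E d} (hf : DifferentiableAt ℝ f x)
    (hg : DifferentiableAt ℝ g x) (i : Fin d) :
    partialDeriv i (fun y => f y * g y) x =
      f x * partialDeriv i g x + partialDeriv i f x * g x := by
  unfold partialDeriv
  rw [fderiv_fun_mul hf hg]
  simp [mul_comm]

lemma partialDeriv_comm {φ : E d → ℝ} (hφ : ContDiff ℝ ((⊤ : ℕ∞) : WithTop ℕ∞) φ) (i j : Fin d)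
    (x : E d) : partialDeriv i (partialDeriv j φ) x = partialDeriv j (partialDeriv i φ) x := by
  have hd : DifferentiableAt ℝ (fderiv ℝ φ) x :=
    (hφ.fderiv_right (m := ((⊤ : ℕ∞) : WithTop ℕ∞)) (by simp)).differentiable (by simp) x
  have h : ∀ i j : Fin d, partialDeriv i (partialDeriv j φ) x =
      fderiv ℝ (fderiv ℝ φ) x (EuclideanSpace.single i 1) (EuclideanSpace.single j 1) :=
    fun i j => by
      have := (hd.hasFDerivAt.clm_apply
        (hasFDerivAt_const (EuclideanSpace.single j (1 : ℝ)) x)).fderiv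
      change fderiv ℝ (fun y => fderiv ℝ φ y (EuclideanSpace.single j 1)) x _ = _
      rw [this]
      simp
  rw [h, h]
  exact (hφ.contDiffAt.isSymmSndFDerivAt (by
    simpa using WithTop.coe_le_coe.2 (le_top : (2 : ℕ∞) ≤ ⊤))).eq _ _

/-- The divergence-free field `∂_j φ e_i - ∂_i φ e_j`. -/
noncomputable def curlField (φ : E d → ℝ) (i j : Fin d) (x : E d) : E d :=
  partialDeriv j φ x • EuclideanSpace.single i 1 - partialDeriv i φ x • EuclideanSpace.single j 1

lemma clm_curlField (L : E d →L[ℝ] ℝ) (φ : E d → ℝ) (i j : Fin d) (x : E d) :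
    L (curlField φ i j x) = partialDeriv j φ x * L (EuclideanSpace.single i 1) -
      partialDeriv i φ x * L (EuclideanSpace.single j 1) := by
  simp [curlField]

lemma curlField_neg (φ : E d → ℝ) (i j : Fin d) (x : E d) :
    curlField (fun y => -φ y) i j x = -curlField φ i j x := by
  simp only [curlField, partialDeriv, fderiv_fun_neg, neg_apply, neg_smul]
  abel

lemma curlField_eq_zero {φ : E d → ℝ} {x : E d} (hx : x ∉ tsupport φ) (i j : Fin d) :
    curlField φ i j x = 0 := by
  simp [curlField, partialDeriv_eq_zero_of_notMem_tsupport hx]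

lemma continuous_curlField {φ : E d → ℝ} (hφ : ContDiff ℝ ((⊤ : ℕ∞) : WithTop ℕ∞) φ)
    (i j : Fin d) : Continuous (curlField φ i j) :=
  ((contDiff_partialDeriv hφ j).continuous.smul continuous_const).sub
    ((contDiff_partialDeriv hφ i).continuous.smul continuous_const)

lemma hasCompactSupport_curlField {φ : E d → ℝ} (hφ : HasCompactSupport φ) (i j : Fin d) :
    HasCompactSupport (curlField φ i j) :=
  hφ.of_isClosed_subset (isClosed_tsupport _) <| closure_minimal
    (fun _ hx => by_contra fun h => hx (curlField_eq_zero h i j)) (isClosed_tsupport _)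

/-- The integrand is ∂_i(ψ ∂_jφ) - ∂_j(ψ ∂_iφ), since the mixed second derivatives of φ cancel; each
term is a derivative of a compactly supported function. -/
lemma integral_fderiv_curlField {U : Set (E d)} {φ ψ : E d → ℝ} (hφ : IsTestFunction U φ)
    (hψ : ContDiff ℝ ((⊤ : ℕ∞) : WithTop ℕ∞) ψ) (i j : Fin d) :
    ∫ x, fderiv ℝ ψ x (curlField φ i j x) = 0 := by
  have hC : ∀ k, ContDiff ℝ 1 fun x => ψ x * partialDeriv k φ x := fun k =>
    (hψ.mul (contDiff_partialDeriv hφ.smooth k)).of_le (by exact_mod_cast le_top)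
  have hS : ∀ k, HasCompactSupport fun x => ψ x * partialDeriv k φ x := fun k =>
    HasCompactSupport.mul_left (hφ.compact.fderiv_apply ℝ _)
  have hpt : ∀ x, fderiv ℝ ψ x (curlField φ i j x) =
      partialDeriv i (fun x => ψ x * partialDeriv j φ x) x -
        partialDeriv j (fun x => ψ x * partialDeriv i φ x) x := fun x => by
    have hdψ := hψ.differentiable (by simp) x
    have hd : ∀ k, DifferentiableAt ℝ (partialDeriv k φ) x := fun k =>
      (contDiff_partialDeriv hφ.smooth k).differentiable (by simp) x
    rw [partialDeriv_mul hdψ (hd j), partialDeriv_mul hdψ (hd i), clm_curlField,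
      partialDeriv_comm hφ.smooth j i]
    simp only [partialDeriv]
    ring
  simp_rw [hpt]
  rw [integral_sub (integrable_partialDeriv (hC j) (hS j) i)
    (integrable_partialDeriv (hC i) (hS i) j), integral_partialDeriv_eq_zero (hC j) (hS j),
    integral_partialDeriv_eq_zero (hC i) (hS i), sub_zero]

/-! ### Asymptotic flows are bounded -/

lemma IsAsymptoticFlow.exists_bound {R : Set (E d)} {ω : E d → E d}
    (hω : IsAsymptoticFlow Λ R ω) : ∃ M : ℝ, ∀ᵐ x, ‖ω x‖ ≤ M := by
  obtain ⟨M, hM⟩ := (isCompact_newtonPolytope (Λ := Λ)).isBounded.exists_norm_le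
  refine ⟨max M 0, ?_⟩
  filter_upwards [hω.support, hω.mem] with x h₁ h₂
  by_cases hx : x ∈ R
  · exact (hM _ (h₂ hx)).trans (le_max_left _ _)
  · simp [h₁ hx]

lemma integrable_fderiv_apply {U : Set (E d)} {φ : E d → ℝ} (hφ : IsTestFunction U φ)
    {v : E d → E d} (hv : AEMeasurable v) {M : ℝ} (hM : ∀ᵐ x, ‖v x‖ ≤ M) :
    Integrable fun x => fderiv ℝ φ x (v x) := by
  have hc : Continuous (fderiv ℝ φ) := hφ.smooth.continuous_fderiv (by simp)
  have hi : Integrable fun x => ‖fderiv ℝ φ x‖ * M :=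
    ((hc.integrable_of_hasCompactSupport (hφ.compact.fderiv ℝ)).norm).mul_const M
  refine hi.mono' (isBoundedBilinearMap_apply.continuous.comp_aestronglyMeasurable
    (hc.aestronglyMeasurable.prodMk hv.aestronglyMeasurable)) ?_
  filter_upwards [hM] with x hx
  exact ((fderiv ℝ φ x).le_opNorm _).trans (by gcongr)

lemma integrableOn_surfaceTension {R : Set (E d)} (hR : IsCompact R) {ω : E d → E d}
    (hω : AEMeasurable ω) (hmem : ∀ᵐ x, x ∈ R → ω x ∈ newtonPolytope Λ) :
    IntegrableOn (fun x => surfaceTension Λ (ω x)) R := by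
  obtain ⟨f, hf, hfσ⟩ := exists_measurable_eqOn_surfaceTension (Λ := Λ)
  have hmem' : ∀ᵐ x ∂volume.restrict R, ω x ∈ newtonPolytope Λ :=
    (ae_restrict_iff' hR.measurableSet).2 hmem
  have hm : AEStronglyMeasurable (fun x => surfaceTension Λ (ω x)) (volume.restrict R) := by
    refine ((hf.comp_aemeasurable hω).aestronglyMeasurable.mono_measure
      Measure.restrict_le_self).congr ?_
    filter_upwards [hmem'] with x hx using hfσ hx
  have : IsFiniteMeasure (volume.restrict R) := isFiniteMeasure_restrict.2 hR.measure_lt_top.ne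
  refine Integrable.of_bound hm |Real.log Λ.D| ?_
  filter_upwards [hmem'] with x hx using abs_surfaceTension_le hx

/-! ### Flows staying inside the Newton polytope -/

lemma StaysInside.exists_isCompact {U T : Set (E d)} {ω : E d → E d} (h : StaysInside Λ U ω)
    (hT : IsCompact T) (hTU : T ⊆ U) :
    ∃ K : Set (E d), IsCompact K ∧ K ⊆ interior (newtonPolytope Λ) ∧ ∀ᵐ y, y ∈ T → ω y ∈ K := by
  refine hT.induction_on (p := fun T => ∃ K : Set (E d), IsCompact K ∧
    K ⊆ interior (newtonPolytope Λ) ∧ ∀ᵐ y, y ∈ T → ω y ∈ K) ?_ ?_ ?_ ?_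
  · exact ⟨∅, isCompact_empty, empty_subset _, by simp⟩
  · rintro s t hst ⟨K, hK, hKN, h⟩
    exact ⟨K, hK, hKN, h.mono fun y hy hys => hy (hst hys)⟩
  · rintro s t ⟨K, hK, hKN, h⟩ ⟨K', hK', hKN', h'⟩
    refine ⟨K ∪ K', hK.union hK', union_subset hKN hKN', ?_⟩
    filter_upwards [h, h'] with y hy hy'
    rintro (hys | hyt)
    · exact Or.inl (hy hys)
    · exact Or.inr (hy' hyt)
  · intro x hx
    obtain ⟨V, hV, K, hK⟩ := h x (hTU hx)
    exact ⟨V, mem_nhdsWithin_of_mem_nhds hV, K, hK⟩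

lemma exists_bound_fderiv_surfaceTension {K : Set (E d)} (hK : IsCompact K)
    (hKN : K ⊆ interior (newtonPolytope Λ)) :
    ∃ C : ℝ, ∀ s ∈ K, ‖fderiv ℝ (surfaceTension Λ) s‖ ≤ C :=
  hK.exists_bound_of_continuousOn (contDiffOn_fderiv_surfaceTension.continuousOn.mono hKN)

lemma aemeasurable_gauge {ω : E d → E d} (hω : AEMeasurable ω) (i : Fin d) :
    AEMeasurable (gauge Λ ω i) :=
  (measurable_fderiv_apply_const ℝ (surfaceTension Λ) _).comp_aemeasurable hω

lemma abs_gauge_le (ω : E d → E d) (i : Fin d) (x : E d) :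
    ‖gauge Λ ω i x‖ ≤ ‖fderiv ℝ (surfaceTension Λ) (ω x)‖ := by
  refine ((fderiv ℝ (surfaceTension Λ) (ω x)).le_opNorm _).trans ?_
  simp

lemma StaysInside.locallyIntegrableOn_gauge {U : Set (E d)} {ω : E d → E d}
    (h : StaysInside Λ U ω) (hω : AEMeasurable ω) (i : Fin d) :
    LocallyIntegrableOn (gauge Λ ω i) U := by
  intro x hx
  obtain ⟨V, hV, K, hK, hKN, hVK⟩ := h x hx
  obtain ⟨C, hC⟩ := exists_bound_fderiv_surfaceTension hK hKN
  obtain ⟨r, hr, hrV⟩ := Metric.mem_nhds_iff.1 hV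
  refine ⟨Metric.ball x r, mem_nhdsWithin_of_mem_nhds (Metric.ball_mem_nhds x hr), ?_⟩
  refine Measure.integrableOn_of_bounded measure_ball_lt_top.ne
    (aemeasurable_gauge hω i).aestronglyMeasurable
    (M := C) ?_
  refine (ae_restrict_iff' measurableSet_ball).2 ?_
  filter_upwards [hVK] with y hy hyr
  exact (abs_gauge_le ω i y).trans (hC _ (hy (hrV hyr)))

/-! ### First variation -/

lemma add_smul_curlField_mem_AF {R U : Set (E d)} {b : SignedMeasure (E d)} {ω : E d → E d}
    (hω : ω ∈ AF Λ R b) {φ : E d → ℝ} (hφ : IsTestFunction U φ) (hUR : U ⊆ interior R)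
    (i j : Fin d) (t : ℝ)
    (ht : ∀ᵐ x, x ∈ tsupport φ → ω x + t • curlField φ i j x ∈ newtonPolytope Λ) :
    (fun x => ω x + t • curlField φ i j x) ∈ AF Λ R b := by
  obtain ⟨M, hM⟩ := hω.1.exists_bound
  have hηc := continuous_curlField hφ.smooth i j
  have hsupp : tsupport φ ⊆ interior R := hφ.support.trans hUR
  obtain ⟨C, hC⟩ := hηc.bounded_above_of_compact_support (hasCompactSupport_curlField hφ.compact i j)
  -- Used with S the interior of R for the divergence, and with S = R for the boundary value.
  have hint : ∀ (ψ : E d → ℝ) (S V : Set (E d)), tsupport φ ⊆ S → IsTestFunction V ψ →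
      ∫ x in S, fderiv ℝ ψ x (ω x + t • curlField φ i j x) =
        ∫ x in S, fderiv ℝ ψ x (ω x) := fun ψ S V hS hψ => by
    have h₁ := integrable_fderiv_apply hψ hω.1.aemeasurable hM
    have h₂ := integrable_fderiv_apply hψ hηc.aemeasurable (ae_of_all _ hC)
    simp_rw [map_add, map_smul]
    have h₃ : Integrable fun x => t • fderiv ℝ ψ x (curlField φ i j x) := h₂.smul t
    rw [integral_add h₁.integrableOn h₃.integrableOn, integral_smul,
      setIntegral_eq_integral_of_forall_compl_eq_zero (f := fun x =>
        fderiv ℝ ψ x (curlField φ i j x)) (fun x hx => by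
        rw [curlField_eq_zero (fun h => hx (hS h)), map_zero]),
      integral_fderiv_curlField hφ hψ.smooth, smul_zero, add_zero]
  refine ⟨⟨hω.1.aemeasurable.add (hηc.aemeasurable.const_smul t), ?_, ?_, ?_⟩, ?_⟩
  · filter_upwards [hω.1.support] with x hx hxR
    rw [hx hxR, curlField_eq_zero fun h => hxR (interior_subset (hsupp h))]
    simp
  · intro ψ hψ
    rw [hint ψ _ _ hsupp hψ]
    exact hω.1.divFree ψ hψ
  · filter_upwards [hω.1.mem, ht] with x hx hxt hxR
    by_cases h : x ∈ tsupport φ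
    · exact hxt h
    · rw [curlField_eq_zero h, smul_zero, add_zero]
      exact hx hxR
  · intro ψ hψ
    rw [hint ψ _ _ (hsupp.trans interior_subset) hψ]
    exact hω.2 ψ hψ

/-- Convexity bounds σ(ω + tη) - σ(ω) above by t Dσ(ω + tη)(η). Minimality makes the integral of
this bound nonnegative for small t > 0, and dominated convergence lets t tend to 0. -/
lemma IsLimitShape.integral_fderiv_curlField_nonneg {R U : Set (E d)} (hR : IsCompact R)
    {b : SignedMeasure (E d)} {ω : E d → E d} (hω : IsLimitShape Λ R b ω) (hUR : U ⊆ interior R)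
    (hU : StaysInside Λ U ω) {φ : E d → ℝ} (hφ : IsTestFunction U φ) (i j : Fin d) :
    0 ≤ ∫ x in R, fderiv ℝ (surfaceTension Λ) (ω x) (curlField φ i j x) := by
  have hηc := continuous_curlField hφ.smooth i j
  have hη_supp := hasCompactSupport_curlField hφ.compact i j
  set η := curlField φ i j with hη
  obtain ⟨C, hC⟩ := hηc.bounded_above_of_compact_support hη_supp
  have hC0 : 0 ≤ C := (norm_nonneg _).trans (hC 0)
  obtain ⟨K, hK, hKN, hωK⟩ := hU.exists_isCompact hφ.compact hφ.support
  -- The margin δ keeps ω + tη in a fixed compact part of the interior while t C ≤ δ; there Dσ is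
  -- bounded.
  obtain ⟨δ, hδ, hδN⟩ := hK.exists_cthickening_subset_open isOpen_interior hKN
  have hK' : IsCompact (Metric.cthickening δ K) := hK.cthickening
  obtain ⟨B, hB⟩ := exists_bound_fderiv_surfaceTension hK' hδN
  have hsmall : ∀ᶠ t : ℝ in 𝓝[>] 0, t * C ≤ δ := by
    have h : Filter.Tendsto (fun t : ℝ => t * C) (𝓝[>] 0) (𝓝 0) := by
      have : ContinuousAt (fun t : ℝ => t * C) 0 := by fun_prop
      simpa [ContinuousAt] using this.tendsto.mono_left nhdsWithin_le_nhds
    exact h (Iic_mem_nhds hδ)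
  have hmem : ∀ t : ℝ, 0 < t → t * C ≤ δ →
      ∀ᵐ x, x ∈ tsupport φ → ω x + t • η x ∈ Metric.cthickening δ K := fun t ht0 ht => by
    filter_upwards [hωK] with x hx hxφ
    refine Metric.mem_cthickening_of_dist_le _ _ _ _ (hx hxφ) ?_
    rw [dist_eq_norm, add_sub_cancel_left, norm_smul, Real.norm_eq_abs, abs_of_pos ht0]
    exact (mul_le_mul_of_nonneg_left (hC x) ht0.le).trans ht
  have hmeas : ∀ t : ℝ, AEStronglyMeasurable
      (fun x => fderiv ℝ (surfaceTension Λ) (ω x + t • η x) (η x)) (volume.restrict R) :=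
    fun t => (isBoundedBilinearMap_apply.continuous.comp_aestronglyMeasurable
      (((measurable_fderiv ℝ (surfaceTension Λ)).comp_aemeasurable
        (hω.1.1.aemeasurable.add (hηc.aemeasurable.const_smul t))).aestronglyMeasurable.prodMk
        hηc.aestronglyMeasurable)).mono_measure Measure.restrict_le_self
  have hbound : ∀ t : ℝ, 0 < t → t * C ≤ δ → ∀ᵐ x ∂volume.restrict R,
      ‖fderiv ℝ (surfaceTension Λ) (ω x + t • η x) (η x)‖ ≤ B * ‖η x‖ := fun t ht0 ht => by
    refine ae_restrict_of_ae ?_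
    filter_upwards [hmem t ht0 ht] with x hx
    by_cases hxφ : x ∈ tsupport φ
    · exact (ContinuousLinearMap.le_opNorm _ _).trans (by gcongr; exact hB _ (hx hxφ))
    · simp [hη, curlField_eq_zero hxφ]
  have hdom : Integrable (fun x => B * ‖η x‖) (volume.restrict R) :=
    ((hηc.integrable_of_hasCompactSupport hη_supp).norm.const_mul B).integrableOn
  have hlim : Filter.Tendsto
      (fun t : ℝ => ∫ x in R, fderiv ℝ (surfaceTension Λ) (ω x + t • η x) (η x)) (𝓝[>] 0)
      (𝓝 (∫ x in R, fderiv ℝ (surfaceTension Λ) (ω x) (η x))) := by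
    refine tendsto_integral_filter_of_dominated_convergence (fun x => B * ‖η x‖)
      (Filter.Eventually.of_forall hmeas) ?_ hdom ?_
    · filter_upwards [hsmall, self_mem_nhdsWithin] with t ht ht0 using hbound t ht0 ht
    · refine ae_restrict_of_ae ?_
      filter_upwards [hωK] with x hx
      by_cases hxφ : x ∈ tsupport φ
      · have hcont : ContinuousAt (fderiv ℝ (surfaceTension Λ)) (ω x) :=
          contDiffOn_fderiv_surfaceTension.continuousOn.continuousAt
            (isOpen_interior.mem_nhds (hKN (hx hxφ)))
        have hline : Filter.Tendsto (fun t : ℝ => ω x + t • η x) (𝓝[>] 0) (𝓝 (ω x)) := by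
          have : ContinuousAt (fun t : ℝ => ω x + t • η x) 0 := by fun_prop
          simpa [ContinuousAt] using this.tendsto.mono_left nhdsWithin_le_nhds
        exact (ContinuousLinearMap.apply ℝ ℝ (η x)).continuous.continuousAt.tendsto.comp
          (hcont.tendsto.comp hline)
      · simp [hη, curlField_eq_zero hxφ]
  refine ge_of_tendsto hlim ?_
  filter_upwards [hsmall, self_mem_nhdsWithin] with t ht ht0
  have ht0' : 0 < t := ht0
  have hAF := add_smul_curlField_mem_AF hω.1 hφ hUR i j t
    ((hmem t ht0 ht).mono fun x hx hxφ => interior_subset (hδN (hx hxφ)))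
  have hle := hω.2 _ hAF
  have hi₁ := integrableOn_surfaceTension hR hω.1.1.aemeasurable hω.1.1.mem
  have hi₂ := integrableOn_surfaceTension hR hAF.1.aemeasurable hAF.1.mem
  have hi₃ : IntegrableOn (fun x => fderiv ℝ (surfaceTension Λ) (ω x + t • η x) (η x)) R :=
    hdom.mono' (hmeas t) (hbound t ht0 ht)
  have hcmp : (∫ x in R, surfaceTension Λ (ω x + t • η x)) -
      ∫ x in R, surfaceTension Λ (ω x) ≤
        t * ∫ x in R, fderiv ℝ (surfaceTension Λ) (ω x + t • η x) (η x) := by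
    rw [← integral_sub hi₂ hi₁, ← integral_const_mul]
    refine integral_mono_ae (hi₂.sub hi₁) (hi₃.const_mul t) ?_
    refine (ae_restrict_iff' hR.measurableSet).2 ?_
    filter_upwards [hmem t ht0 ht, hω.1.1.mem] with x hx hxN hxR
    by_cases hxφ : x ∈ tsupport φ
    · have h := fderiv_surfaceTension_le (hδN (hx hxφ)) (hxN hxR)
      rw [sub_add_cancel_left, map_neg, map_smul, smul_eq_mul] at h
      linarith
    · simp [hη, curlField_eq_zero hxφ]
  have : 0 ≤ t * ∫ x in R, fderiv ℝ (surfaceTension Λ) (ω x + t • η x) (η x) := by linarith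
  exact nonneg_of_mul_nonneg_right this ht0'

lemma IsLimitShape.solvesELWeakly {R U : Set (E d)} (hR : IsCompact R)
    {b : SignedMeasure (E d)} {ω : E d → E d} (hω : IsLimitShape Λ R b ω) (hUR : U ⊆ interior R)
    (hU : StaysInside Λ U ω) : SolvesELWeakly Λ U ω := by
  refine ⟨hU.locallyIntegrableOn_gauge hω.1.1.aemeasurable, fun i j _ φ hφ => ?_⟩
  have h₁ := hω.integral_fderiv_curlField_nonneg hR hUR hU hφ i j
  have h₂ := hω.integral_fderiv_curlField_nonneg hR hUR hU hφ.neg i j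
  simp_rw [curlField_neg, map_neg] at h₂
  rw [integral_neg] at h₂
  have hzero : ∀ x, x ∉ tsupport φ →
      fderiv ℝ (surfaceTension Λ) (ω x) (curlField φ i j x) = 0 := fun x hx => by
    rw [curlField_eq_zero hx, map_zero]
  rw [setIntegral_eq_integral_of_forall_compl_eq_zero fun x hx =>
    hzero x fun h => hx (interior_subset (hUR (hφ.support h)))] at h₁ h₂
  have hEL : ∀ x, gauge Λ ω j x * partialDeriv i φ x - gauge Λ ω i x * partialDeriv j φ x =
      -fderiv ℝ (surfaceTension Λ) (ω x) (curlField φ i j x) := fun x => by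
    rw [clm_curlField]
    simp only [gauge, partialDeriv]
    ring
  simp_rw [hEL]
  rw [integral_neg, setIntegral_eq_integral_of_forall_compl_eq_zero fun x hx =>
    hzero x fun h => hx (hφ.support h)]
  linarith

/-! ### The classical system -/

lemma integrable_mul_of_tsupport_subset {U : Set (E d)} {h ψ : E d → ℝ} (hh : ContinuousOn h U)
    (hψ : Continuous ψ) (hc : HasCompactSupport ψ) (hU : tsupport ψ ⊆ U) :
    Integrable fun x => h x * ψ x := by
  refine (integrableOn_iff_integrable_of_support_subset (s := tsupport ψ) fun x hx =>
    subset_tsupport ψ fun h0 => hx ?_).1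
    (((hh.mono hU).mul hψ.continuousOn).integrableOn_compact hc)
  simp only [h0, mul_zero]

lemma continuousOn_partialDeriv {U : Set (E d)} (hU : IsOpen U) {g : E d → ℝ}
    (hg : ContDiffOn ℝ 1 g U) (i : Fin d) : ContinuousOn (partialDeriv i g) U :=
  (hg.continuousOn_fderiv_of_isOpen hU le_rfl).clm_apply continuousOn_const

lemma integral_mul_partialDeriv {U : Set (E d)} (hU : IsOpen U) {g φ : E d → ℝ}
    (hg : ContDiffOn ℝ 1 g U) (hφ : IsTestFunction U φ) (i : Fin d) :
    ∫ x, g x * partialDeriv i φ x = -∫ x, partialDeriv i g x * φ x :=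
  integral_mul_fderiv_eq_neg_fderiv_mul_of_integrable
    (integrable_mul_of_tsupport_subset (continuousOn_partialDeriv hU hg i) hφ.smooth.continuous
      hφ.compact hφ.support)
    (integrable_mul_of_tsupport_subset hg.continuousOn
      (contDiff_partialDeriv hφ.smooth i).continuous (hφ.compact.fderiv_apply ℝ _)
      ((tsupport_partialDeriv_subset φ i).trans hφ.support))
    (integrable_mul_of_tsupport_subset hg.continuousOn hφ.smooth.continuous hφ.compact hφ.support)
    (fun x hx => (hg.contDiffAt (hU.mem_nhds (hφ.support hx))).differentiableAt one_ne_zero)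
    (fun x _ => hφ.smooth.differentiable (by simp) x)

lemma integrable_mul_partialDeriv {U : Set (E d)} {g φ : E d → ℝ} (hg : ContinuousOn g U)
    (hφ : IsTestFunction U φ) (i : Fin d) : Integrable fun x => g x * partialDeriv i φ x :=
  integrable_mul_of_tsupport_subset hg (contDiff_partialDeriv hφ.smooth i).continuous
    (hφ.compact.fderiv_apply ℝ _) ((tsupport_partialDeriv_subset φ i).trans hφ.support)

lemma eq_zero_of_forall_integral_mul_eq_zero {U : Set (E d)} (hU : IsOpen U) {h : E d → ℝ}
    (hh : ContinuousOn h U) (H : ∀ φ : E d → ℝ, IsTestFunction U φ → ∫ x, h x * φ x = 0) :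
    ∀ x ∈ U, h x = 0 := by
  have hae : ∀ᵐ x, x ∈ U → h x = 0 :=
    hU.ae_eq_zero_of_integral_contDiff_smul_eq_zero
      (hh.locallyIntegrableOn hU.measurableSet) fun g hg hc hs => by
        simpa [mul_comm] using H g ⟨hg, hc, hs⟩
  exact Measure.eqOn_open_of_ae_eq ((ae_restrict_iff' hU.measurableSet).2 hae) hU hh
    continuousOn_const

lemma staysInside_of_continuousOn {U : Set (E d)} (hU : IsOpen U) {ω : E d → E d}
    (hω : ContinuousOn ω U) (hmem : ∀ x ∈ U, ω x ∈ interior (newtonPolytope Λ)) :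
    StaysInside Λ U ω := by
  intro x hx
  obtain ⟨r, hr, hsub⟩ := Metric.nhds_basis_closedBall.mem_iff.1
    (isOpen_interior.mem_nhds (hmem x hx))
  exact ⟨ω ⁻¹' Metric.closedBall (ω x) r,
    (hω.continuousAt (hU.mem_nhds hx)).preimage_mem_nhds (Metric.closedBall_mem_nhds _ hr),
    _, isCompact_closedBall _ _, hsub, ae_of_all _ fun y hy => hy⟩

lemma contDiffOn_gauge {U : Set (E d)} {ω : E d → E d} (hω : ContDiffOn ℝ 1 ω U)
    (hmem : ∀ x ∈ U, ω x ∈ interior (newtonPolytope Λ)) (i : Fin d) :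
    ContDiffOn ℝ 1 (gauge Λ ω i) U :=
  (((contDiffOn_fderiv_surfaceTension (Λ := Λ)).of_le (by exact_mod_cast le_top)).comp hω
    hmem).clm_apply contDiffOn_const

lemma IsDivFree.sum_partialDeriv_eq_zero {U V : Set (E d)} (hU : IsOpen U) (hUV : U ⊆ V)
    {ω : E d → E d} (hdiv : IsDivFree V ω) (hω : ContDiffOn ℝ 1 ω U) :
    ∀ x ∈ U, ∑ i, partialDeriv i (fun y => ω y i) x = 0 := by
  have hC : ∀ i, ContDiffOn ℝ 1 (fun y => ω y i) U := fun i =>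
    (EuclideanSpace.proj (𝕜 := ℝ) i).contDiff.comp_contDiffOn hω
  refine eq_zero_of_forall_integral_mul_eq_zero hU
    (continuousOn_finsetSum _ fun i _ => continuousOn_partialDeriv hU (hC i) i) fun φ hφ => ?_
  have h := hdiv φ (hφ.mono hUV)
  rw [setIntegral_eq_integral_of_forall_compl_eq_zero fun x hx => by
    rw [fderiv_eq_zero_of_notMem_tsupport fun h => hx (hUV (hφ.support h)), zero_apply]] at h
  simp_rw [fderiv_eq_sum_partialDeriv, mul_comm (partialDeriv _ φ _)] at h
  rw [integral_finsetSum _ fun i _ => integrable_mul_partialDeriv (hC i).continuousOn hφ i] at h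
  simp_rw [Finset.sum_mul]
  rw [integral_finsetSum _ fun i _ => integrable_mul_of_tsupport_subset
    (continuousOn_partialDeriv hU (hC i) i) hφ.smooth.continuous hφ.compact hφ.support]
  simp_rw [integral_mul_partialDeriv hU (hC _) hφ] at h
  rwa [Finset.sum_neg_distrib, neg_eq_zero] at h

lemma SolvesELWeakly.partialDeriv_eq {U : Set (E d)} (hU : IsOpen U) {ω : E d → E d}
    (hω : ∀ i, ContDiffOn ℝ 1 (gauge Λ ω i) U) (hEL : SolvesELWeakly Λ U ω) {i j : Fin d}
    (hij : i ≠ j) :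
    ∀ x ∈ U, partialDeriv i (gauge Λ ω j) x - partialDeriv j (gauge Λ ω i) x = 0 := by
  have hcont : ∀ i j, ContinuousOn (partialDeriv i (gauge Λ ω j)) U := fun i j =>
    continuousOn_partialDeriv hU (hω j) i
  refine eq_zero_of_forall_integral_mul_eq_zero hU ((hcont i j).sub (hcont j i)) fun φ hφ => ?_
  have h := hEL.2 i j hij φ hφ
  rw [setIntegral_eq_integral_of_forall_compl_eq_zero fun x hx => by
    have hx' : x ∉ tsupport φ := fun h => hx (hφ.support h)
    rw [partialDeriv_eq_zero_of_notMem_tsupport hx', partialDeriv_eq_zero_of_notMem_tsupport hx']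
    ring,
    integral_sub (integrable_mul_partialDeriv (hω j).continuousOn hφ i)
      (integrable_mul_partialDeriv (hω i).continuousOn hφ j),
    integral_mul_partialDeriv hU (hω j) hφ, integral_mul_partialDeriv hU (hω i) hφ] at h
  simp_rw [sub_mul]
  rw [integral_sub
    (integrable_mul_of_tsupport_subset (hcont i j) hφ.smooth.continuous hφ.compact hφ.support)
    (integrable_mul_of_tsupport_subset (hcont j i) hφ.smooth.continuous hφ.compact hφ.support)]
  linarith

lemma IsLimitShape.solvesELClassically {R U : Set (E d)} (hR : IsCompact R)
    {b : SignedMeasure (E d)} {ω : E d → E d} (hω : IsLimitShape Λ R b ω) (hU : IsOpen U)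
    (hUR : U ⊆ interior R) (hC : ContDiffOn ℝ 1 ω U)
    (hmem : ∀ x ∈ U, ω x ∈ interior (newtonPolytope Λ)) : SolvesELClassically Λ U ω := by
  have hEL := hω.solvesELWeakly hR hUR (staysInside_of_continuousOn hU hC.continuousOn hmem)
  exact fun x hx => ⟨hω.1.1.divFree.sum_partialDeriv_eq_zero hU hUR hC x hx,
    fun i j hij => hEL.partialDeriv_eq hU (contDiffOn_gauge hC hmem) hij x hx⟩

/-! ### The Poincaré lemma on star-shaped domains -/

/-- The potential integrates B along segments from x₀. Near x only the hull of x₀ and a small ball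
matters; star-convexity keeps it in O, and the convex Poincaré lemma applies there. -/
lemma exists_hasFDerivAt_of_starConvex {O : Set (E d)} {x₀ : E d} (hO : IsOpen O)
    (hstar : StarConvex ℝ x₀ O) {B : E d → E d →L[ℝ] ℝ} (hB : DifferentiableOn ℝ B O)
    (hsymm : ∀ x ∈ O, ∀ v w, fderiv ℝ B x v w = fderiv ℝ B x w v) :
    ∃ f : E d → ℝ, ∀ x ∈ O, HasFDerivAt f (B x) x := by
  refine ⟨fun y => curveIntegral B (.segment x₀ y), fun x hx => ?_⟩
  obtain ⟨r, hr, hball⟩ := Metric.isOpen_iff.1 hO x hx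
  set s : Set (E d) := convexHull ℝ (insert x₀ (Metric.ball x r)) with hs
  have hsO : s ⊆ O := by
    rw [hs, convexHull_insert ⟨x, Metric.mem_ball_self hr⟩, (convex_ball x r).convexHull_eq]
    intro z hz
    obtain ⟨p, hp, y, hy, hzy⟩ := mem_convexJoin.1 hz
    rw [mem_singleton_iff] at hp
    subst hp
    exact hstar.segment_subset (hball hy) hzy
  have hsub : insert x₀ (Metric.ball x r) ⊆ s := subset_convexHull ℝ _
  have hsx : s ∈ 𝓝 x := Filter.mem_of_superset (Metric.ball_mem_nhds x hr)
    ((subset_insert _ _).trans hsub)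
  exact ((convex_convexHull ℝ _).hasFDerivWithinAt_curveIntegral_segment_of_hasFDerivWithinAt_symmetric
    (fun y hy => (hB.differentiableAt (hO.mem_nhds (hsO hy))).hasFDerivAt.hasFDerivWithinAt)
    (fun y hy v _ w _ => hsymm y (hsO hy) v w) (hsub (mem_insert _ _))
    (mem_of_mem_nhds hsx)).hasFDerivAt hsx

/-! ### Mollification -/

/-- The convolution of `a` with the normalized bump function `ρ`. -/
noncomputable def mollify (ρ : ContDiffBump (0 : E d)) (a : E d → ℝ) : E d → ℝ :=
  convolution (ρ.normed volume) a (ContinuousLinearMap.lsmul ℝ ℝ) volume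

lemma contDiff_mollify (ρ : ContDiffBump (0 : E d)) {a : E d → ℝ} (ha : LocallyIntegrable a) :
    ContDiff ℝ ((⊤ : ℕ∞) : WithTop ℕ∞) (mollify ρ a) :=
  ρ.hasCompactSupport_normed.contDiff_convolution_left _ ρ.contDiff_normed ha

lemma contDiff_comp_const_sub {ψ : E d → ℝ} (hψ : ContDiff ℝ ((⊤ : ℕ∞) : WithTop ℕ∞) ψ)
    (x : E d) : ContDiff ℝ ((⊤ : ℕ∞) : WithTop ℕ∞) fun y => ψ (x - y) :=
  hψ.comp (contDiff_const.sub contDiff_id)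

lemma partialDeriv_comp_const_sub {ψ : E d → ℝ} (hψ : Differentiable ℝ ψ) (i : Fin d)
    (x y : E d) : partialDeriv i (fun z => ψ (x - z)) y = -partialDeriv i ψ (x - y) := by
  have h : HasFDerivAt (fun z : E d => x - z) (-ContinuousLinearMap.id ℝ (E d)) y :=
    (hasFDerivAt_id y).const_sub x
  have := ((hψ (x - y)).hasFDerivAt.comp y h).fderiv
  simp only [partialDeriv]
  rw [show (fun z => ψ (x - z)) = ψ ∘ fun z => x - z from rfl, this]
  simp

lemma partialDeriv_mollify (ρ : ContDiffBump (0 : E d)) {a : E d → ℝ} (ha : LocallyIntegrable a)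
    (i : Fin d) (x : E d) : partialDeriv i (mollify ρ a) x =
      -∫ y, a y * partialDeriv i (fun z => ρ.normed volume (x - z)) y := by
  have hρ : ContDiff ℝ ((⊤ : ℕ∞) : WithTop ℕ∞) (ρ.normed (volume : Measure (E d))) :=
    ρ.contDiff_normed
  have hc : HasCompactSupport (ρ.normed (volume : Measure (E d))) := ρ.hasCompactSupport_normed
  have h := (hc.hasFDerivAt_convolution_right (ContinuousLinearMap.lsmul ℝ ℝ).flip ha
    (hρ.of_le (by exact_mod_cast le_top)) x).fderiv
  rw [convolution_flip] at h
  rw [partialDeriv, mollify, h, convolution_precompR_apply _ ha (hc.fderiv ℝ)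
    (hρ.continuous_fderiv (by simp)), convolution_def, ← integral_neg]
  refine integral_congr_ae (ae_of_all _ fun y => ?_)
  simp only [partialDeriv_comp_const_sub (hρ.differentiable (by simp))]
  simp [partialDeriv, mul_comm]

/-- The translated reflected bump y ↦ ρ(x - y) is itself an admissible test function for the weak
curl equation. -/
lemma partialDeriv_mollify_comm {V : Set (E d)} {a : Fin d → E d → ℝ}
    (ha : ∀ i, LocallyIntegrable (a i))
    (hcurl : ∀ i j, ∀ φ : E d → ℝ, IsTestFunction V φ →
      ∫ x, (a j x * partialDeriv i φ x - a i x * partialDeriv j φ x) = 0)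
    (ρ : ContDiffBump (0 : E d)) {x : E d} (hx : Metric.closedBall x ρ.rOut ⊆ V) (i j : Fin d) :
    partialDeriv i (mollify ρ (a j)) x = partialDeriv j (mollify ρ (a i)) x := by
  have hρ : ContDiff ℝ ((⊤ : ℕ∞) : WithTop ℕ∞) (ρ.normed (volume : Measure (E d))) :=
    ρ.contDiff_normed
  have hsupp : tsupport (fun z => ρ.normed volume (x - z)) ⊆ Metric.closedBall x ρ.rOut := by
    refine closure_minimal (fun z hz => ?_) Metric.isClosed_closedBall
    have : x - z ∈ Function.support (ρ.normed (volume : Measure (E d))) := hz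
    rw [ρ.support_normed_eq, mem_ball_zero_iff] at this
    rw [mem_closedBall_iff_norm, norm_sub_rev]
    exact this.le
  have hcs : HasCompactSupport (fun z => ρ.normed volume (x - z)) :=
    (isCompact_closedBall x ρ.rOut).of_isClosed_subset (isClosed_tsupport _) hsupp
  have htest : IsTestFunction V (fun z => ρ.normed volume (x - z)) :=
    ⟨contDiff_comp_const_sub hρ x, hcs, hsupp.trans hx⟩
  have hint : ∀ i j, Integrable
      fun y => a j y * partialDeriv i (fun z => ρ.normed volume (x - z)) y := fun i j => by
    have := (ha j).integrable_smul_right_of_hasCompactSupport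
      (contDiff_partialDeriv htest.smooth i).continuous (htest.compact.fderiv_apply ℝ _)
    simpa using this
  have h := hcurl i j _ htest
  rw [integral_sub (hint i j) (hint j i)] at h
  rw [partialDeriv_mollify ρ (ha j), partialDeriv_mollify ρ (ha i)]
  linarith

lemma integrable_mollify (ρ : ContDiffBump (0 : E d)) {a : E d → ℝ} (ha : Integrable a) :
    Integrable (mollify ρ a) :=
  ρ.integrable_normed.integrable_convolution _ ha

lemma integral_norm_mollify_le (ρ : ContDiffBump (0 : E d)) {a : E d → ℝ} (ha : Integrable a) :
    ∫ x, ‖mollify ρ a x‖ ≤ ∫ x, ‖a x‖ := by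
  calc ∫ x, ‖mollify ρ a x‖ ≤ ∫ x, mollify ρ (fun y => ‖a y‖) x := by
        refine integral_mono (integrable_mollify ρ ha).norm (integrable_mollify ρ ha.norm)
          fun x => ?_
        simp only [mollify, convolution_def]
        refine (norm_integral_le_integral_norm _).trans_eq
          (integral_congr_ae (ae_of_all _ fun y => ?_))
        simp [abs_of_nonneg (ρ.nonneg_normed y)]
    _ = ∫ x, ‖a x‖ := by
        unfold mollify
        rw [integral_convolution _ ρ.integrable_normed ha.norm, ρ.integral_normed]
        simp

lemma mollify_sub (ρ : ContDiffBump (0 : E d)) {a g : E d → ℝ} (ha : LocallyIntegrable a)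
    (hg : LocallyIntegrable g) (x : E d) :
    mollify ρ (fun y => a y - g y) x = mollify ρ a x - mollify ρ g x := by
  have h : ∀ {a : E d → ℝ}, LocallyIntegrable a →
      ConvolutionExists (ρ.normed volume) a (ContinuousLinearMap.lsmul ℝ ℝ) volume := fun ha =>
    ρ.hasCompactSupport_normed.convolutionExists_left _ ρ.continuous_normed ha
  unfold mollify
  simp only [convolution_def]
  rw [← integral_sub (h ha x) (h hg x)]
  simp [mul_sub]

/-! ### Dilations -/

/-- The dilation with centre `x₀` and factor `t`. -/
noncomputable def dilate (x₀ : E d) (t : ℝ) (x : E d) : E d := x₀ + t • (x - x₀)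

lemma dilate_eq (x₀ : E d) (t : ℝ) (x : E d) : dilate x₀ t x = t • x + (x₀ - t • x₀) := by
  simp only [dilate, smul_sub]
  abel

lemma dilate_dilate (x₀ : E d) (s t : ℝ) (x : E d) :
    dilate x₀ s (dilate x₀ t x) = dilate x₀ (s * t) x := by
  simp [dilate, mul_smul]

lemma dist_dilate (x₀ : E d) {t : ℝ} (ht : 0 ≤ t) (x y : E d) :
    dist (dilate x₀ t x) (dilate x₀ t y) = t * dist x y := by
  rw [dilate_eq, dilate_eq, dist_add_right, dist_smul₀, Real.norm_of_nonneg ht]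

lemma dist_dilate_self (x₀ : E d) {t : ℝ} (ht : t ≤ 1) (x : E d) :
    dist (dilate x₀ t x) x = (1 - t) * dist x x₀ := by
  have : dilate x₀ t x - x = -((1 - t) • (x - x₀)) := by
    simp only [dilate, sub_smul, one_smul]
    abel
  rw [dist_eq_norm, this, norm_neg, norm_smul, Real.norm_of_nonneg (by linarith), dist_eq_norm]

lemma continuous_dilate (x₀ : E d) : Continuous fun p : ℝ × E d => dilate x₀ p.1 p.2 := by
  unfold dilate
  fun_prop

lemma integral_comp_dilate (x₀ : E d) (t : ℝ) (f : E d → ℝ) :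
    ∫ x, f (dilate x₀ t x) = |(t ^ d)⁻¹| * ∫ x, f x := by
  simp_rw [dilate_eq]
  rw [Measure.integral_comp_smul volume (fun z => f (z + (x₀ - t • x₀))),
    integral_add_right_eq_self f]
  simp

lemma integrable_comp_dilate (x₀ : E d) {t : ℝ} (ht : t ≠ 0) {f : E d → ℝ} (hf : Integrable f) :
    Integrable fun x => f (dilate x₀ t x) := by
  simp_rw [dilate_eq]
  exact (hf.comp_add_right (x₀ - t • x₀)).comp_smul ht

/-- Mollified dilations of an integrable function converge to it in `L¹`. -/
lemma exists_integral_norm_mollify_dilate_sub_le {a : E d → ℝ} (ha : Integrable a)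
    {R : Set (E d)} (hR : IsCompact R) (x₀ : E d) {κ : ℝ} (hκ : 0 < κ) :
    ∃ δ > 0, δ < 1 ∧ ∀ t, 1 - δ < t → t < 1 → ∀ ρ : ContDiffBump (0 : E d), ρ.rOut < δ →
      ∫ x in R, ‖mollify ρ a (dilate x₀ t x) - a x‖ ≤ κ := by
  -- Budget: replacing a by g costs this amount once directly and at most 2 ^ d times more after
  -- dilation, the Jacobian t ^ (-d) being at most 2 ^ d for t > 1/2. That is κ/2 in all; the
  -- uniform error 2κ₂ for g on R uses the rest.
  have hκ' : 0 < κ / (2 * (2 ^ d + 1)) := by positivity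
  obtain ⟨g, hgs, hag, hgc, hgi⟩ := ha.exists_hasCompactSupport_integral_sub_le hκ'
  have hvol : 0 ≤ volume.real R := measureReal_nonneg
  set κ₂ := κ / (4 * (volume.real R + 1)) with hκ₂
  have hκ₂0 : 0 < κ₂ := by positivity
  obtain ⟨δ₀, hδ₀, hunif⟩ := Metric.uniformContinuous_iff.1
    (hgs.uniformContinuous_of_continuous hgc) κ₂ hκ₂0
  obtain ⟨r, hr0, hr⟩ := hR.isBounded.subset_closedBall_lt 0 x₀
  -- The bound δ₀ / r is there because the dilation moves points of R by at most (1 - t) r.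
  refine ⟨min (1 / 2) (min δ₀ (δ₀ / r)), by positivity, by
    exact (min_le_left _ _).trans_lt (by norm_num), fun t ht ht1 ρ hρ => ?_⟩
  have ht2 : 1 / 2 < t := by
    have := min_le_left (1 / 2) (min δ₀ (δ₀ / r))
    linarith
  have htr : (1 - t) * r < δ₀ := by
    rw [← lt_div_iff₀ hr0]
    have := (min_le_right (1 / 2) (min δ₀ (δ₀ / r))).trans (min_le_right _ _)
    linarith
  have hρ' : ρ.rOut < δ₀ :=
    hρ.trans_le ((min_le_right _ _).trans (min_le_left _ _))
  have hfin : IsFiniteMeasure (volume.restrict R) :=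
    isFiniteMeasure_restrict.2 hR.measure_lt_top.ne
  have hg_close : ∀ x ∈ R, ‖mollify ρ g (dilate x₀ t x) - g x‖ ≤ 2 * κ₂ := fun x hx => by
    have h₁ : dist (mollify ρ g (dilate x₀ t x)) (g (dilate x₀ t x)) ≤ κ₂ :=
      ρ.dist_normed_convolution_le hgc.aestronglyMeasurable fun y hy =>
        (hunif ((Metric.mem_ball.1 hy).trans hρ')).le
    have h₂ : dist (g (dilate x₀ t x)) (g x) ≤ κ₂ := by
      refine (hunif ?_).le
      rw [dist_dilate_self x₀ ht1.le]
      exact (mul_le_mul_of_nonneg_left (hr hx) (by linarith)).trans_lt htr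
    rw [← dist_eq_norm]
    linarith [dist_triangle (mollify ρ g (dilate x₀ t x)) (g (dilate x₀ t x)) (g x)]
  have hsub : Integrable fun x => a x - g x := ha.sub hgi
  have hI₁ : Integrable fun x => ‖mollify ρ (fun y => a y - g y) (dilate x₀ t x)‖ :=
    (integrable_comp_dilate x₀ (by linarith) (integrable_mollify ρ hsub)).norm
  have hI₂ : Integrable fun x => ‖a x - g x‖ := hsub.norm
  have hB₁ : ∫ x in R, ‖mollify ρ (fun y => a y - g y) (dilate x₀ t x)‖ ≤
      2 ^ d * (κ / (2 * (2 ^ d + 1))) := by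
    refine (setIntegral_le_integral hI₁ (ae_of_all _ fun x => norm_nonneg _)).trans ?_
    rw [integral_comp_dilate x₀ t fun z => ‖mollify ρ (fun y => a y - g y) z‖]
    have ht0 : (0 : ℝ) < t := by linarith
    have hpow : |(t ^ d)⁻¹| ≤ 2 ^ d := by
      rw [abs_of_pos (by positivity), ← inv_pow]
      gcongr
      rw [inv_le_comm₀ ht0 two_pos]
      linarith
    exact mul_le_mul hpow ((integral_norm_mollify_le ρ hsub).trans hag)
      (integral_nonneg fun x => norm_nonneg _) (by positivity)
  have hB₂ : ∫ x in R, ‖a x - g x‖ ≤ κ / (2 * (2 ^ d + 1)) :=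
    (setIntegral_le_integral hI₂ (ae_of_all _ fun x => norm_nonneg _)).trans hag
  calc ∫ x in R, ‖mollify ρ a (dilate x₀ t x) - a x‖
      ≤ ∫ x in R, ((‖mollify ρ (fun y => a y - g y) (dilate x₀ t x)‖ + ‖a x - g x‖) + 2 * κ₂) := by
        refine setIntegral_mono_on ?_ ((hI₁.add hI₂).integrableOn.add (integrable_const _))
          hR.measurableSet fun x hx => ?_
        · exact (((integrable_comp_dilate x₀ (by linarith) (integrable_mollify ρ ha)).sub
            ha).norm).integrableOn
        · have h := hg_close x hx
          have heq : mollify ρ a (dilate x₀ t x) - a x =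
              mollify ρ (fun y => a y - g y) (dilate x₀ t x) - (a x - g x) +
                (mollify ρ g (dilate x₀ t x) - g x) := by
            rw [mollify_sub ρ ha.locallyIntegrable hgi.locallyIntegrable]
            ring
          rw [heq]
          exact (norm_add_le _ _).trans (add_le_add (norm_sub_le _ _) h)
    _ = (∫ x in R, ‖mollify ρ (fun y => a y - g y) (dilate x₀ t x)‖) +
          (∫ x in R, ‖a x - g x‖) + volume.real R * (2 * κ₂) := by
        have hI₃ : IntegrableOn (fun x => ‖mollify ρ (fun y => a y - g y) (dilate x₀ t x)‖ +
          ‖a x - g x‖) R := (hI₁.add hI₂).integrableOn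
        rw [integral_add hI₃ (integrable_const _), integral_add hI₁.integrableOn
          hI₂.integrableOn]
        simp
    _ ≤ 2 ^ d * (κ / (2 * (2 ^ d + 1))) + κ / (2 * (2 ^ d + 1)) + κ / 2 := by
        gcongr
        rw [hκ₂, ← mul_assoc, ← mul_div_assoc, div_le_div_iff₀ (by positivity) two_pos]
        nlinarith
    _ = κ := by
        field_simp
        ring

/-! ### Curl-free fields are orthogonal to fields without flux and divergence -/

/-- A bounded field supported in `R` that annihilates gradients of test functions annihilates
gradients of functions that are smooth near `R`. -/
lemma setIntegral_fderiv_eq_zero_of_contDiffOn {R O : Set (E d)} (hR : IsCompact R)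
    (hO : IsOpen O) (hRO : R ⊆ O) {η : E d → E d}
    (hη : ∀ φ : E d → ℝ, IsTestFunction univ φ → ∫ x in R, fderiv ℝ φ x (η x) = 0)
    {f : E d → ℝ} (hf : ContDiffOn ℝ ((⊤ : ℕ∞) : WithTop ℕ∞) f O) :
    ∫ x in R, fderiv ℝ f x (η x) = 0 := by
  obtain ⟨W, hW, hRW, hWO⟩ := exists_compact_between hR hO hRO
  -- With χ = 1 near R, χ f is a global test function with the same derivative as f at points of R.
  obtain ⟨χ, hχ1, hχ0, -⟩ := exists_contMDiffMap_one_nhds_of_subset_interior (n := ⊤)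
    (modelWithCornersSelf ℝ (E d)) hR.isClosed hRW
  have hχ : ContDiff ℝ ((⊤ : ℕ∞) : WithTop ℕ∞) χ := χ.contMDiff.contDiff
  have hsupp : tsupport (fun x => χ x * f x) ⊆ W := by
    refine closure_minimal (fun x hx => by_contra fun h => hx ?_) hW.isClosed
    simp [hχ0 x h]
  have hsmooth : ContDiff ℝ ((⊤ : ℕ∞) : WithTop ℕ∞) fun x => χ x * f x :=
    contDiff_iff_contDiffAt.2 fun x => by
      by_cases hx : x ∈ tsupport fun x => χ x * f x
      · exact hχ.contDiffAt.mul (hf.contDiffAt (hO.mem_nhds (hWO (hsupp hx))))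
      · exact (contDiffAt_const (c := (0 : ℝ))).congr_of_eventuallyEq
          (notMem_tsupport_iff_eventuallyEq.1 hx)
  have h := hη _ ⟨hsmooth, hW.of_isClosed_subset (isClosed_tsupport _) hsupp, subset_univ _⟩
  rw [← h]
  refine setIntegral_congr_fun hR.measurableSet fun x hx => ?_
  have hev : (fun x => χ x * f x) =ᶠ[𝓝 x] f := by
    filter_upwards [Filter.Eventually.filter_mono (nhds_le_nhdsSet hx) hχ1] with y hy
    rw [hy, one_mul]
  simp only [hev.fderiv_eq]

/-- If the dilations of `R` with factors in `[0, 1)` lie in the interior of `R`, then each of them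
maps a star-shaped open neighbourhood of `R` into the interior, at distance more than some `ε`
from its complement. -/
lemma exists_starConvex_nhds {R : Set (E d)} (hR : IsCompact R) {x₀ : E d}
    (hstar : ∀ x ∈ R, ∀ t : ℝ, 0 ≤ t → t < 1 → dilate x₀ t x ∈ interior R) {t : ℝ} (ht0 : 0 ≤ t)
    (ht1 : t < 1) :
    ∃ ε > 0, ∃ O, IsOpen O ∧ R ⊆ O ∧ StarConvex ℝ x₀ O ∧
      ∀ x ∈ O, Metric.closedBall (dilate x₀ t x) ε ⊆ interior R := by
  -- The union of the segments from x₀ to R is compact and star-shaped, and so its thickenings are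
  -- star-shaped.
  set C₁ : Set (E d) := (fun p : ℝ × E d => dilate x₀ p.1 p.2) '' (Icc 0 1 ×ˢ R) with hC₁
  have hC₁c : IsCompact C₁ := (isCompact_Icc.prod hR).image (continuous_dilate x₀)
  have hC : IsCompact (dilate x₀ t '' C₁) :=
    hC₁c.image ((continuous_dilate x₀).comp (by fun_prop : Continuous fun x : E d => (t, x)))
  have hCR : dilate x₀ t '' C₁ ⊆ interior R := by
    rintro _ ⟨_, ⟨⟨s, x⟩, ⟨hs, hx⟩, rfl⟩, rfl⟩
    simp only [dilate_dilate]
    exact hstar x hx _ (mul_nonneg ht0 hs.1) ((mul_le_of_le_one_right ht0 hs.2).trans_lt ht1)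
  obtain ⟨δ, hδ, hsub⟩ := hC.exists_thickening_subset_open isOpen_interior hCR
  -- One δ/3 pays for leaving C₁, another for the closed ball; the sum stays below δ.
  refine ⟨δ / 3, by positivity, Metric.thickening (δ / 3) C₁, Metric.isOpen_thickening,
    fun x hx => Metric.self_subset_thickening (by positivity) _
      ⟨(1, x), ⟨⟨zero_le_one, le_rfl⟩, hx⟩, by simp [dilate]⟩, ?_, ?_⟩
  · intro y hy p q hp hq hpq
    obtain ⟨_, ⟨⟨s, x⟩, ⟨hs, hx⟩, rfl⟩, hyc⟩ := Metric.mem_thickening_iff.1 hy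
    have hq1 : q ≤ 1 := by linarith
    have heq : p • x₀ + q • y = dilate x₀ q y := by
      rw [dilate_eq, eq_sub_of_add_eq hpq, sub_smul, one_smul]
      abel
    refine Metric.mem_thickening_iff.2 ⟨dilate x₀ q (dilate x₀ s x), ?_, ?_⟩
    · rw [dilate_dilate]
      exact ⟨(q * s, x), ⟨⟨mul_nonneg hq hs.1, mul_le_one₀ hq1 hs.1 hs.2⟩, hx⟩, rfl⟩
    · rw [heq, dist_dilate x₀ hq]
      exact (mul_le_of_le_one_left dist_nonneg hq1).trans_lt hyc
  · intro x hx y hy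
    obtain ⟨c, hc, hxc⟩ := Metric.mem_thickening_iff.1 hx
    refine hsub (Metric.mem_thickening_iff.2 ⟨dilate x₀ t c, mem_image_of_mem _ hc, ?_⟩)
    have h₁ : dist (dilate x₀ t x) (dilate x₀ t c) ≤ dist x c := by
      rw [dist_dilate x₀ ht0]
      exact mul_le_of_le_one_left dist_nonneg ht1.le
    have h₂ := Metric.mem_closedBall.1 hy
    linarith [dist_triangle y (dilate x₀ t x) (dilate x₀ t c)]

/-- The one-form with coefficients `A i`. -/
noncomputable def oneForm (A : Fin d → E d → ℝ) (x : E d) : E d →L[ℝ] ℝ :=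
  ∑ i, A i x • (EuclideanSpace.proj i : E d →L[ℝ] ℝ)

lemma oneForm_apply (A : Fin d → E d → ℝ) (x v : E d) : oneForm A x v = ∑ i, A i x * v i := by
  simp [oneForm]

lemma contDiff_oneForm {A : Fin d → E d → ℝ}
    (hA : ∀ i, ContDiff ℝ ((⊤ : ℕ∞) : WithTop ℕ∞) (A i)) :
    ContDiff ℝ ((⊤ : ℕ∞) : WithTop ℕ∞) (oneForm A) :=
  ContDiff.sum fun i _ => (hA i).smul contDiff_const

lemma fderiv_oneForm_apply {A : Fin d → E d → ℝ} {x : E d}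
    (hA : ∀ i, DifferentiableAt ℝ (A i) x) (v w : E d) :
    fderiv ℝ (oneForm A) x v w = ∑ i, ∑ j, partialDeriv j (A i) x * v j * w i := by
  have h : HasFDerivAt (oneForm A) (∑ i, (fderiv ℝ (A i) x).smulRight
      (EuclideanSpace.proj i : E d →L[ℝ] ℝ)) x :=
    HasFDerivAt.fun_sum fun i _ =>
      (hA i).hasFDerivAt.smul_const (EuclideanSpace.proj i : E d →L[ℝ] ℝ)
  rw [h.fderiv]
  simp [fderiv_eq_sum_partialDeriv, Finset.sum_mul]

lemma fderiv_oneForm_symm {A : Fin d → E d → ℝ} {x : E d}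
    (hA : ∀ i, DifferentiableAt ℝ (A i) x)
    (hcurl : ∀ i j, partialDeriv i (A j) x = partialDeriv j (A i) x) (v w : E d) :
    fderiv ℝ (oneForm A) x v w = fderiv ℝ (oneForm A) x w v := by
  rw [fderiv_oneForm_apply hA, fderiv_oneForm_apply hA, Finset.sum_comm]
  refine Finset.sum_congr rfl fun i _ => Finset.sum_congr rfl fun j _ => ?_
  rw [hcurl i j]
  ring

lemma partialDeriv_comp_dilate {f : E d → ℝ} (hf : Differentiable ℝ f) (x₀ : E d) (t : ℝ)
    (i : Fin d) (x : E d) :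
    partialDeriv i (fun y => f (dilate x₀ t y)) x = t * partialDeriv i f (dilate x₀ t x) := by
  have h : HasFDerivAt (dilate x₀ t) (t • ContinuousLinearMap.id ℝ (E d)) x :=
    (((hasFDerivAt_id x).sub_const x₀).const_smul t).const_add x₀
  have := ((hf (dilate x₀ t x)).hasFDerivAt.comp x h).fderiv
  simp only [partialDeriv]
  rw [show (fun y => f (dilate x₀ t y)) = f ∘ dilate x₀ t from rfl, this]
  simp

lemma contDiff_comp_dilate {f : E d → ℝ} (hf : ContDiff ℝ ((⊤ : ℕ∞) : WithTop ℕ∞) f)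
    (x₀ : E d) (t : ℝ) :
    ContDiff ℝ ((⊤ : ℕ∞) : WithTop ℕ∞) fun y => f (dilate x₀ t y) := by
  unfold dilate
  fun_prop

/-- A mollified dilation of a curl-free field is orthogonal to `η`. -/
lemma setIntegral_mollify_dilate_eq_zero {R : Set (E d)} (hR : IsCompact R) {x₀ : E d}
    (hstar : ∀ x ∈ R, ∀ t : ℝ, 0 ≤ t → t < 1 → dilate x₀ t x ∈ interior R)
    {a : Fin d → E d → ℝ} (ha : ∀ i, LocallyIntegrable (a i))
    (hcurl : ∀ i j, ∀ φ : E d → ℝ, IsTestFunction (interior R) φ →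
      ∫ x, (a j x * partialDeriv i φ x - a i x * partialDeriv j φ x) = 0)
    {η : E d → E d}
    (hη : ∀ φ : E d → ℝ, IsTestFunction univ φ → ∫ x in R, fderiv ℝ φ x (η x) = 0)
    {t : ℝ} (ht0 : 0 ≤ t) (ht1 : t < 1) :
    ∃ ε > 0, ∀ ρ : ContDiffBump (0 : E d), ρ.rOut ≤ ε →
      ∫ x in R, ∑ i, mollify ρ (a i) (dilate x₀ t x) * η x i = 0 := by
  obtain ⟨ε, hε, O, hO, hRO, hOstar, hball⟩ := exists_starConvex_nhds hR hstar ht0 ht1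
  refine ⟨ε, hε, fun ρ hρ => ?_⟩
  set A : Fin d → E d → ℝ := fun i x => mollify ρ (a i) (dilate x₀ t x) with hA
  have hms : ∀ i, Differentiable ℝ (mollify ρ (a i)) := fun i =>
    (contDiff_mollify ρ (ha i)).differentiable (by simp)
  have hAs : ∀ i, ContDiff ℝ ((⊤ : ℕ∞) : WithTop ℕ∞) (A i) := fun i =>
    contDiff_comp_dilate (contDiff_mollify ρ (ha i)) x₀ t
  have hBs := contDiff_oneForm hAs
  -- At the dilated point the mollifier sees only the interior of R. The chain rule factor t is
  -- common to both sides.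
  have hAcurl : ∀ x ∈ O, ∀ i j, partialDeriv i (A j) x = partialDeriv j (A i) x :=
    fun x hx i j => by
      rw [partialDeriv_comp_dilate (hms j), partialDeriv_comp_dilate (hms i),
        partialDeriv_mollify_comm ha hcurl ρ
          ((Metric.closedBall_subset_closedBall hρ).trans (hball x hx)) i j]
  obtain ⟨f, hf⟩ := exists_hasFDerivAt_of_starConvex hO hOstar
    (hBs.differentiable (by simp)).differentiableOn fun x hx =>
      fderiv_oneForm_symm (fun i => (hAs i).differentiable (by simp) x) (hAcurl x hx)
  have hfs : ContDiffOn ℝ ((⊤ : ℕ∞) : WithTop ℕ∞) f O :=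
    (contDiffOn_infty_iff_fderiv_of_isOpen hO).2
      ⟨fun x hx => (hf x hx).differentiableAt.differentiableWithinAt,
        hBs.contDiffOn.congr fun x hx => (hf x hx).fderiv⟩
  rw [← setIntegral_fderiv_eq_zero_of_contDiffOn hR hO hRO hη hfs]
  refine setIntegral_congr_fun hR.measurableSet fun x hx => ?_
  simp only [(hf x (hRO hx)).fderiv, oneForm_apply, hA]

lemma abs_apply_le (v : E d) (i : Fin d) : |v i| ≤ ‖v‖ := by
  simpa using PiLp.norm_apply_le v i

/-- An integrable field that is curl-free in the interior of a star-shaped region is orthogonal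
to every bounded field on the region without divergence and without flux through the boundary. -/
lemma setIntegral_sum_mul_eq_zero {R : Set (E d)} (hR : IsCompact R) {x₀ : E d}
    (hstar : ∀ x ∈ R, ∀ t : ℝ, 0 ≤ t → t < 1 → dilate x₀ t x ∈ interior R)
    {a : Fin d → E d → ℝ} (ha : ∀ i, Integrable (a i))
    (hcurl : ∀ i j, ∀ φ : E d → ℝ, IsTestFunction (interior R) φ →
      ∫ x, (a j x * partialDeriv i φ x - a i x * partialDeriv j φ x) = 0)
    {η : E d → E d} (hηm : AEMeasurable η) {M : ℝ} (hM : ∀ᵐ x, ‖η x‖ ≤ M)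
    (hη : ∀ φ : E d → ℝ, IsTestFunction univ φ → ∫ x in R, fderiv ℝ φ x (η x) = 0) :
    ∫ x in R, ∑ i, a i x * η x i = 0 := by
  have hM0 : 0 ≤ M := by
    obtain ⟨x, hx⟩ := hM.exists
    exact (norm_nonneg _).trans hx
  have hηi : ∀ i, AEStronglyMeasurable (fun x => η x i) volume := fun i =>
    ((EuclideanSpace.proj (𝕜 := ℝ) i : E d →L[ℝ] ℝ).continuous.measurable.comp_aemeasurable
      hηm).aestronglyMeasurable
  have hmul : ∀ {g : E d → ℝ} (i : Fin d), Integrable g → Integrable fun x => g x * η x i :=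
    fun {g} i hg => by
      refine (hg.norm.mul_const M).mono' (hg.aestronglyMeasurable.mul (hηi i)) ?_
      filter_upwards [hM] with x hx
      rw [norm_mul]
      gcongr
      exact (abs_apply_le _ _).trans hx
  refine abs_nonpos_iff.1 (le_of_forall_pos_le_add fun κ hκ => ?_)
  rw [zero_add]
  have hκ' : 0 < κ / ((d + 1) * (M + 1)) := by positivity
  choose δ hδ hδ1 hlim using fun i =>
    exists_integral_norm_mollify_dilate_sub_le (ha i) hR x₀ hκ'
  obtain ⟨δ₀, hδ₀, hδ₀1, hδ₀le⟩ : ∃ δ₀ > 0, δ₀ < 1 ∧ ∀ i, δ₀ ≤ δ i := by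
    rcases isEmpty_or_nonempty (Fin d) with hd | hd
    · exact ⟨1 / 2, by norm_num, by norm_num, fun i => hd.elim i⟩
    · obtain ⟨i, hi⟩ := Finite.exists_min δ
      exact ⟨δ i, hδ i, hδ1 i, hi⟩
  -- The dilation is fixed first: the admissible mollification radius ε depends on t, whereas the L¹
  -- estimate is uniform in both.
  set t : ℝ := 1 - δ₀ / 2 with ht
  have ht1 : t < 1 := by linarith
  obtain ⟨ε, hε, hzero⟩ := setIntegral_mollify_dilate_eq_zero hR hstar
    (fun i => (ha i).locallyIntegrable) hcurl hη (t := t) (by linarith) ht1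
  set r := min ε (δ₀ / 2) with hr
  have hr0 : 0 < r := by positivity
  let ρ : ContDiffBump (0 : E d) := ⟨r / 2, r, by positivity, by linarith⟩
  have hz := hzero ρ (min_le_left _ _)
  have hmi : ∀ i, Integrable fun x => mollify ρ (a i) (dilate x₀ t x) := fun i =>
    integrable_comp_dilate x₀ (by linarith) (integrable_mollify ρ (ha i))
  have hI₁ : IntegrableOn (fun x => ∑ i, mollify ρ (a i) (dilate x₀ t x) * η x i) R :=
    (integrable_finsetSum _ fun i _ => hmul i (hmi i)).integrableOn
  have hI₂ : IntegrableOn (fun x => ∑ i, a i x * η x i) R :=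
    (integrable_finsetSum _ fun i _ => hmul i (ha i)).integrableOn
  have hdi : ∀ i, IntegrableOn (fun x => ‖mollify ρ (a i) (dilate x₀ t x) - a i x‖) R := fun i =>
    ((hmi i).sub (ha i)).norm.integrableOn
  calc |∫ x in R, ∑ i, a i x * η x i|
      = ‖∫ x in R, (∑ i, mollify ρ (a i) (dilate x₀ t x) * η x i - ∑ i, a i x * η x i)‖ := by
        rw [integral_sub hI₁ hI₂, hz, zero_sub, norm_neg, Real.norm_eq_abs]
    _ ≤ ∫ x in R, ∑ i, ‖mollify ρ (a i) (dilate x₀ t x) - a i x‖ * M := by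
        refine norm_integral_le_of_norm_le
          (integrable_finsetSum _ fun i _ => (hdi i).mul_const M) (ae_restrict_of_ae ?_)
        filter_upwards [hM] with x hx
        rw [← Finset.sum_sub_distrib]
        refine (norm_sum_le _ _).trans (Finset.sum_le_sum fun i _ => ?_)
        rw [← sub_mul, norm_mul]
        gcongr
        exact (abs_apply_le _ _).trans hx
    _ = ∑ i, (∫ x in R, ‖mollify ρ (a i) (dilate x₀ t x) - a i x‖) * M := by
        rw [integral_finsetSum _ fun i _ => (hdi i).mul_const M]
        simp_rw [integral_mul_const]
    _ ≤ ∑ _i : Fin d, κ / ((d + 1) * (M + 1)) * M := by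
        gcongr with i
        refine hlim i t ?_ ht1 ρ ?_
        · linarith [hδ₀le i]
        · exact (min_le_right _ _).trans_lt (by linarith [hδ₀le i])
    _ ≤ κ := by
        rw [Finset.sum_const, Finset.card_univ, Fintype.card_fin, nsmul_eq_mul, div_mul_eq_mul_div,
          ← mul_div_assoc, div_le_iff₀ (by positivity)]
        have : (0 : ℝ) ≤ d := Nat.cast_nonneg d
        nlinarith [mul_nonneg this hM0]

/-! ### Solutions on star-shaped regions are limit shape flows -/

/-- The equal boundary values make ω' - ω orthogonal to gradients of all test functions, while
∇σ(ω), extended by zero outside R, is integrable and curl-free in the interior. -/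
lemma setIntegral_fderiv_surfaceTension_sub_eq_zero {R : Set (E d)} (hR : IsCompact R)
    {b : SignedMeasure (E d)} {x₀ : E d}
    (hstar : ∀ x ∈ R, ∀ t : ℝ, 0 ≤ t → t < 1 → x₀ + t • (x - x₀) ∈ interior R)
    {ω ω' : E d → E d} (hω : ω ∈ AF Λ R b) (hω' : ω' ∈ AF Λ R b)
    (hint : ∀ i, IntegrableOn (gauge Λ ω i) R) (hEL : SolvesELWeakly Λ (interior R) ω) :
    ∫ x in R, fderiv ℝ (surfaceTension Λ) (ω x) (ω' x - ω x) = 0 := by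
  obtain ⟨M, hM⟩ := hω.1.exists_bound
  obtain ⟨M', hM'⟩ := hω'.1.exists_bound
  have hcurl : ∀ i j, ∀ φ : E d → ℝ, IsTestFunction (interior R) φ →
      ∫ x, (R.indicator (gauge Λ ω j) x * partialDeriv i φ x -
        R.indicator (gauge Λ ω i) x * partialDeriv j φ x) = 0 := fun i j φ hφ => by
    rcases eq_or_ne i j with rfl | hij
    · simp
    rw [← hEL.2 i j hij φ hφ, ← integral_indicator isOpen_interior.measurableSet]
    refine integral_congr_ae (ae_of_all _ fun x => ?_)
    by_cases hx : x ∈ interior R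
    · simp [hx, interior_subset hx]
    · have hx' : x ∉ tsupport φ := fun h => hx (hφ.support h)
      simp [hx, partialDeriv_eq_zero_of_notMem_tsupport hx']
  have hη : ∀ φ : E d → ℝ, IsTestFunction univ φ →
      ∫ x in R, fderiv ℝ φ x (ω' x - ω x) = 0 := fun φ hφ => by
    simp_rw [map_sub]
    rw [integral_sub (integrable_fderiv_apply hφ hω'.1.aemeasurable hM').integrableOn
      (integrable_fderiv_apply hφ hω.1.aemeasurable hM).integrableOn, hω'.2 φ hφ, hω.2 φ hφ,
      sub_self]
  have hbd : ∀ᵐ x, ‖ω' x - ω x‖ ≤ M' + M := by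
    filter_upwards [hM, hM'] with x h h'
    exact (norm_sub_le _ _).trans (add_le_add h' h)
  rw [← setIntegral_sum_mul_eq_zero hR hstar
    (fun i => (hint i).integrable_indicator hR.measurableSet) hcurl
    (hω'.1.aemeasurable.sub hω.1.aemeasurable) hbd hη]
  refine setIntegral_congr_fun hR.measurableSet fun x hx => ?_
  simp [fderiv_eq_sum_partialDeriv, hx, gauge]

lemma isLimitShape_and_unique_of_solvesELWeakly {R : Set (E d)} (hR : IsCompact R)
    {b : SignedMeasure (E d)} {x₀ : E d}
    (hstar : ∀ x ∈ R, ∀ t : ℝ, 0 ≤ t → t < 1 → x₀ + t • (x - x₀) ∈ interior R)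
    {ω : E d → E d} (hω : ω ∈ AF Λ R b)
    (hmem : ∀ᵐ x, x ∈ R → ω x ∈ interior (newtonPolytope Λ))
    (hint : ∀ i, IntegrableOn (gauge Λ ω i) R) (hEL : SolvesELWeakly Λ (interior R) ω) :
    IsLimitShape Λ R b ω ∧ ∀ ω', IsLimitShape Λ R b ω' → ω' =ᵐ[volume] ω := by
  have hσ := integrableOn_surfaceTension hR hω.1.aemeasurable hω.1.mem
  have hgrad : ∀ ω' ∈ AF Λ R b, IntegrableOn
      (fun x => fderiv ℝ (surfaceTension Λ) (ω x) (ω' x - ω x)) R := fun ω' hω' => by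
    obtain ⟨M, hM⟩ := hω.1.exists_bound
    obtain ⟨M', hM'⟩ := hω'.1.exists_bound
    have hm : AEMeasurable fun x => ω' x - ω x := hω'.1.aemeasurable.sub hω.1.aemeasurable
    simp_rw [fderiv_eq_sum_partialDeriv]
    refine integrable_finsetSum _ fun i _ => ?_
    refine ((hint i).norm.mul_const (M' + M)).mono' ((hint i).aestronglyMeasurable.mul
      (((EuclideanSpace.proj (𝕜 := ℝ) i : E d →L[ℝ] ℝ).continuous.measurable.comp_aemeasurable
        hm).aestronglyMeasurable.mono_measure Measure.restrict_le_self)) (ae_restrict_of_ae ?_)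
    filter_upwards [hM, hM'] with x h h'
    rw [norm_mul]
    refine mul_le_mul_of_nonneg_left ?_ (norm_nonneg _)
    exact (abs_apply_le _ _).trans ((norm_sub_le _ _).trans (add_le_add h' h))
  -- This Bregman divergence is nonnegative, and its integral is the difference of the two energies
  -- because the linear term integrates to zero.
  have hpt : ∀ ω' ∈ AF Λ R b, ∀ᵐ x ∂volume.restrict R,
      0 ≤ surfaceTension Λ (ω' x) - surfaceTension Λ (ω x) -
        fderiv ℝ (surfaceTension Λ) (ω x) (ω' x - ω x) := fun ω' hω' => by
    refine (ae_restrict_iff' hR.measurableSet).2 ?_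
    filter_upwards [hmem, hω'.1.mem] with x h h' hx
    exact sub_nonneg.2 (fderiv_surfaceTension_le (h hx) (h' hx))
  have hdiff : ∀ ω' ∈ AF Λ R b,
      ∫ x in R, (surfaceTension Λ (ω' x) - surfaceTension Λ (ω x) -
        fderiv ℝ (surfaceTension Λ) (ω x) (ω' x - ω x)) =
      (∫ x in R, surfaceTension Λ (ω' x)) - ∫ x in R, surfaceTension Λ (ω x) := fun ω' hω' => by
    have hσ' := integrableOn_surfaceTension hR hω'.1.aemeasurable hω'.1.mem
    have hsub : IntegrableOn
      (fun x => surfaceTension Λ (ω' x) - surfaceTension Λ (ω x)) R := hσ'.sub hσ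
    rw [integral_sub hsub (hgrad ω' hω'), integral_sub hσ' hσ,
      setIntegral_fderiv_surfaceTension_sub_eq_zero hR hstar hω hω' hint hEL, sub_zero]
  have hmin : IsLimitShape Λ R b ω := ⟨hω, fun ω' hω' => by
    have := integral_nonneg_of_ae (hpt ω' hω')
    rw [hdiff ω' hω'] at this
    linarith⟩
  refine ⟨hmin, fun ω' hω' => ?_⟩
  have hσ' := integrableOn_surfaceTension hR hω'.1.1.aemeasurable hω'.1.1.mem
  -- Two minimizers have equal energy, so the divergence vanishes almost everywhere on R, which is
  -- equality in the subgradient inequality.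
  have hzero := (integral_eq_zero_iff_of_nonneg_ae (hpt ω' hω'.1)
    ((hσ'.sub hσ).sub (hgrad ω' hω'.1))).1 (by
      rw [hdiff ω' hω'.1, le_antisymm (hω'.2 ω hω) (hmin.2 ω' hω'.1), sub_self])
  filter_upwards [(ae_restrict_iff' hR.measurableSet).1 hzero, hmem, hω'.1.1.mem, hω.1.support,
    hω'.1.1.support] with x hx hxN hxN' h0 h0'
  by_cases hxR : x ∈ R
  · have h : _ = (0 : ℝ) := hx hxR
    exact eq_of_fderiv_surfaceTension_eq (hxN hxR) (hxN' hxR) (sub_eq_zero.1 h).symm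
  · rw [h0 hxR, h0' hxR]

end MultinomialDimer

theorem mainTheorem8 {d : ℕ} (Λ : MultinomialDimer.DimerLattice d)
    (R : Set (MultinomialDimer.E d)) (hR : IsCompact R)
    (b : SignedMeasure (MultinomialDimer.E d)) :
    -- the derivatives of the surface tension exist where they are used
    ContDiffOn ℝ ((⊤ : ℕ∞) : WithTop ℕ∞) (MultinomialDimer.surfaceTension Λ)
      (interior (MultinomialDimer.newtonPolytope Λ)) ∧
    -- the limit shape flow solves the system
    (∀ ω : MultinomialDimer.E d → MultinomialDimer.E d,
      MultinomialDimer.IsLimitShape Λ R b ω →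
        MultinomialDimer.IsDivFree (interior R) ω ∧
        (∀ U : Set (MultinomialDimer.E d), IsOpen U → U ⊆ interior R →
          MultinomialDimer.StaysInside Λ U ω → MultinomialDimer.SolvesELWeakly Λ U ω) ∧
        (∀ U : Set (MultinomialDimer.E d), IsOpen U → U ⊆ interior R →
          ContDiffOn ℝ 1 ω U →
          (∀ x ∈ U, ω x ∈ interior (MultinomialDimer.newtonPolytope Λ)) →
          MultinomialDimer.SolvesELClassically Λ U ω)) ∧
    -- on strictly star-shaped regions a solution of the system is the limit shape flow
    (∀ x₀ : MultinomialDimer.E d,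
      (∀ x ∈ R, ∀ t : ℝ, 0 ≤ t → t < 1 → x₀ + t • (x - x₀) ∈ interior R) →
      ∀ ω ∈ MultinomialDimer.AF Λ R b,
        (∀ᵐ x, x ∈ R → ω x ∈ interior (MultinomialDimer.newtonPolytope Λ)) →
        (∀ i, IntegrableOn (MultinomialDimer.gauge Λ ω i) R) →
        MultinomialDimer.SolvesELWeakly Λ (interior R) ω →
        MultinomialDimer.IsLimitShape Λ R b ω ∧
        ∀ ω', MultinomialDimer.IsLimitShape Λ R b ω' → ω' =ᵐ[volume] ω) := by
  refine ⟨MultinomialDimer.contDiffOn_surfaceTension, fun ω hω => ⟨hω.1.1.divFree,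
    fun U _ hUR hU => hω.solvesELWeakly hR hUR hU,
    fun U hU hUR hC hmem => hω.solvesELClassically hR hU hUR hC hmem⟩,
    fun x₀ hstar ω hω hmem hint hEL =>
      MultinomialDimer.isLimitShape_and_unique_of_solvesELWeakly hR hstar hω hmem hint hEL⟩
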